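/- **Setting.** An instance of Election-Control-by-Seeding (ECS) consists of candidates $c_0,\dots,c_\ell$ ($\ell\ge1$), a finite nonempty set $V$ of voters, a directed graph $(V,E)$ with strengths $p:V\times V\to[0,1]$, injective scores $\pi_v:\{c_0,\dots,c_\ell\}\to\mathbb N$ ($v\in V$) and a budget $B\in\mathbb N$. A solution $(S,M)$ is a set $S\subseteq V$ of seeds with a message $m_s\in\mathbb Z^{\ell+1}$ for every $s\in S$; it is feasible if $|M|=\sum_{s\in S}\sum_i|m_s(i)|\le B$. The live graph $H\subseteq E$ contains each edge $e\in E$ independently with probability $p(e)$. The message of $s$ activates $s$ at time $0$, and at time $t\ge1$ every voter that it has not activated before and that has an incoming edge in $H$ from a voter activated by it at time $t-1$. After the diffusion the score of $c_i$ for $v$ is $(1-\epsilon)\pi_v(i)+\sum_s m_s(i)$, where the sum is over the seeds whose message activates $v$ at some time and $\epsilon=1/(1+\max_{v,i}\pi_v(i))$ (so ties are broken in favor of the candidate ranked lower initially). Let $V^*_c(S,M,H)$ be the set of voters whose highest final score is that of $c$, let $\mathrm{MoV}(S,M,H)=|V^*_{c_0}|-\max_{c\ne c_0}|V^*_c|$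 and $\Delta(S,M)=\mathbb E_H[\mathrm{MoV}(S,M,H)-\mathrm{MoV}(\emptyset,\emptyset,H)]$. A feasible $(S,M)$ is a $\rho$-approximation if $\Delta(S,M)\ge\rho\,\Delta(S',M')$ for all feasible $(S',M')$. Let $\delta=\max_{v\in V,\,i\ne0}(\pi_v(i)-\pi_v(0))$. **Theorem.** For the ECS instances with $1\le\delta\le B$ there is a greedy polynomial-time algorithm that returns a $\rho$-approximation, with $$\rho=\frac{B-\delta+1}{2\,\delta\,B}\Bigl(1-\frac1e\Bigr).$$ Precisely: 1. Let the greedy algorithm select $\min(\lfloor B/\delta\rfloor,|V|)$ distinct seeds one at a time, each sending $\delta$ positive articles on $c_0$ and nothing else, and each chosen so as to maximize $\mathbb E_H|V^*_{c_0}|$ after its addition. However ties are broken, the result is a $\rho$-approximation. 2. There is a randomized algorithm that receives an instance with rational $p$ (all numbers in binary) and a confidence parameter $k\in\mathbb N$ in unary, always runs in time polynomial in the length of this input, always returns a feasible $(S,M)$, and returns a $\rho$-approximation with probability at least $1-2^{-k}$. It builds $(S,M)$ greedily: it starts from $(\emptyset,\emptyset)$ and adds one pair $(s,m_s)$ with a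 new seed $s$ at a time, each addition strictly increasing $\mathbb E_H[\mathrm{MoV}]$ or $\mathbb E_H|V^*_{c_0}|$. -/

import Mathlib

/-! ### Election scenarios, diffusion and margin of victory -/

/-- An instance of Election-Control-by-Seeding: voters `Fin n`, candidates `c_0, …, c_ℓ` (with at
least one opponent of `c_0`), a directed graph with edge set `E` and influence strengths `p`,
injective scores, and a budget `B`. -/
structure ECSInstance where
  n : ℕ
  n_pos : 0 < n
  ℓ : ℕ
  ℓ_pos : 0 < ℓ
  E : Finset (Fin n × Fin n)
  p : Fin n × Fin n → ℝ
  p_nonneg : ∀ e, 0 ≤ p e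
  p_le_one : ∀ e, p e ≤ 1
  score : Fin n → Fin (ℓ + 1) → ℕ
  score_injective : ∀ v, Function.Injective (score v)
  B : ℕ

namespace ECSInstance

abbrev Voter (I : ECSInstance) : Type := Fin I.n

abbrev Candidate (I : ECSInstance) : Type := Fin (I.ℓ + 1)

/-- A message: the number of positive (or minus the number of negative) articles on each
candidate. -/
abbrev Message (I : ECSInstance) : Type := I.Candidate → ℤ

/-- A pair `(S, M)`, as the list of the seeds with their messages in the order of selection.
(That the seeds are distinct is part of `Feasible`.) -/
abbrev Plan (I : ECSInstance) : Type := List (I.Voter × I.Message)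

/-- The seed set of a plan. -/
def seeds {I : ECSInstance} (L : I.Plan) : List I.Voter := L.map Prod.fst

/-- The number of articles of a message. -/
def messageSize {I : ECSInstance} (m : I.Message) : ℕ := ∑ c, (m c).natAbs

/-- The number of articles of a plan, which is its cost. -/
def planSize {I : ECSInstance} (L : I.Plan) : ℕ := (L.map fun sm => messageSize sm.2).sum

/-- The probability that the live graph has exactly the edges `H ⊆ E`. -/
noncomputable def liveProb (I : ECSInstance) (H : Finset (I.Voter × I.Voter)) : ℝ :=
  (∏ e ∈ H, I.p e) * ∏ e ∈ I.E \ H, (1 - I.p e)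

/-- Expectation over the random live graph. -/
noncomputable def expect (I : ECSInstance) (f : Finset (I.Voter × I.Voter) → ℝ) : ℝ :=
  ∑ H ∈ I.E.powerset, I.liveProb H * f H

/-- `(A, U)` where `A` is the set of voters that the message of the seed `s` activates at time `t`
in the live graph `H`, and `U` the set of those that it activates at some time `≤ t`. -/
def cascade {I : ECSInstance} (H : Finset (I.Voter × I.Voter)) (s : I.Voter) :
    ℕ → Finset I.Voter × Finset I.Voter
  | 0 => ({s}, {s})
  | t + 1 =>
    let A := Finset.univ.filter fun v =>
      v ∉ (cascade H s t).2 ∧ ∃ u ∈ (cascade H s t).1, (u, v) ∈ H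
    (A, (cascade H s t).2 ∪ A)

/-- The message of `s` activates `v` at some time. -/
def Influenced {I : ECSInstance} (H : Finset (I.Voter × I.Voter)) (s v : I.Voter) : Prop :=
  ∃ t, v ∈ (cascade H s t).1

/-- The perturbation `ε = 1 / (1 + max π_v(i))`. It breaks ties in favor of the candidate that was
ranked lower before the diffusion. -/
def perturbation (I : ECSInstance) : ℚ :=
  1 / (1 + ((Finset.univ.sup fun v => Finset.univ.sup fun c => I.score v c : ℕ) : ℚ))

open Classical in
/-- The score of candidate `c` for voter `v` after the diffusion. -/
noncomputable def finalScore (I : ECSInstance) (L : I.Plan) (H : Finset (I.Voter × I.Voter))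
    (v : I.Voter) (c : I.Candidate) : ℚ :=
  (1 - I.perturbation) * (I.score v c : ℚ) +
    (L.map fun sm => if Influenced H sm.1 v then ((sm.2 c : ℤ) : ℚ) else 0).sum

open Classical in
/-- The set `V*_c` of voters that rank `c` first after the diffusion. -/
noncomputable def supporters (I : ECSInstance) (L : I.Plan) (H : Finset (I.Voter × I.Voter))
    (c : I.Candidate) : Finset I.Voter :=
  Finset.univ.filter fun v => ∀ d, d ≠ c → I.finalScore L H v d < I.finalScore L H v c

/-- The margin of victory of `c_0`. -/
noncomputable def MoV (I : ECSInstance) (L : I.Plan) (H : Finset (I.Voter × I.Voter)) : ℤ :=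
  ((I.supporters L H 0).card : ℤ) -
    (((Finset.univ.erase (0 : I.Candidate)).sup fun c => (I.supporters L H c).card : ℕ) : ℤ)

/-- Expected margin of victory. -/
noncomputable def expMoV (I : ECSInstance) (L : I.Plan) : ℝ :=
  I.expect fun H => (I.MoV L H : ℝ)

/-- Expected number of votes of `c_0`. -/
noncomputable def expVotes (I : ECSInstance) (L : I.Plan) : ℝ :=
  I.expect fun H => ((I.supporters L H 0).card : ℝ)

/-- The objective: the expected increase of the margin of victory. -/
noncomputable def expGain (I : ECSInstance) (L : I.Plan) : ℝ :=
  I.expect fun H => ((I.MoV L H - I.MoV [] H : ℤ) : ℝ)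

/-- Distinct seeds, and at most `B` articles. -/
def Feasible (I : ECSInstance) (L : I.Plan) : Prop :=
  (seeds L).Nodup ∧ planSize L ≤ I.B

/-- `L` is feasible and its value is at least `ρ` times that of every feasible plan. -/
def IsApprox (I : ECSInstance) (ρ : ℝ) (L : I.Plan) : Prop :=
  I.Feasible L ∧ ∀ L' : I.Plan, I.Feasible L' → ρ * I.expGain L' ≤ I.expGain L

theorem pairs_nonempty (I : ECSInstance) :
    ((Finset.univ : Finset I.Voter) ×ˢ (Finset.univ.erase (0 : I.Candidate))).Nonempty := by
  refine ⟨(⟨0, I.n_pos⟩, ⟨1, by have := I.ℓ_pos; omega⟩), ?_⟩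
  simp [Fin.ext_iff]

/-- `δ = max_{v, c_i ≠ c_0} (π_v(i) - π_v(0))`. -/
def delta (I : ECSInstance) : ℤ :=
  ((Finset.univ : Finset I.Voter) ×ˢ (Finset.univ.erase (0 : I.Candidate))).sup' I.pairs_nonempty
    fun x => (I.score x.1 x.2 : ℤ) - (I.score x.1 0 : ℤ)

/-- `ρ = (B - δ + 1) / (2 δ B) · (1 - 1/e)`. -/
noncomputable def ratio (I : ECSInstance) : ℝ :=
  ((I.B : ℝ) - (I.delta : ℝ) + 1) / (2 * (I.delta : ℝ) * (I.B : ℝ)) * (1 - 1 / Real.exp 1)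

/-! ### Greedy -/

/-- The set `F(S, M)`: the pairs `(s, m_s)`, with `s` not yet a seed, whose addition increases the
expected margin of victory or the expected number of votes of `c_0`. -/
def improvements (I : ECSInstance) (L : I.Plan) : Set (I.Voter × I.Message) :=
  {sm | sm.1 ∉ seeds L ∧
    (I.expMoV L < I.expMoV (L ++ [sm]) ∨ I.expVotes L < I.expVotes (L ++ [sm]))}

/-- The plans that arise from the empty one by adding members of `F(S, M)` one at a time. -/
inductive GreedyBuilt (I : ECSInstance) : I.Plan → Prop
  | nil : GreedyBuilt I []
  | snoc (L : I.Plan) (sm : I.Voter × I.Message) :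
      GreedyBuilt I L → sm ∈ I.improvements L → GreedyBuilt I (L ++ [sm])

/-- All the given seeds send `δ` positive articles on `c_0`. -/
def deltaPlan (I : ECSInstance) (S : List I.Voter) : I.Plan :=
  S.map fun s => (s, Pi.single 0 I.delta)

/-- The runs of the greedy algorithm that adds, at each time, a new seed (sending `δ` positive
articles on `c_0`) that most increases the expected number of votes of `c_0`. -/
inductive GreedySeeds (I : ECSInstance) : List I.Voter → Prop
  | nil : GreedySeeds I []
  | snoc (S : List I.Voter) (s : I.Voter) :
      GreedySeeds I S → s ∉ S →
      (∀ t, t ∉ S → I.expVotes (I.deltaPlan (S ++ [t])) ≤ I.expVotes (I.deltaPlan (S ++ [s]))) →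
      GreedySeeds I (S ++ [s])

end ECSInstance

/-! ### A programming language with a cost model

Values are binary trees with natural numbers at the leaves. Reading and writing a variable, pairing
and projecting cost one step each (they move pointers), arithmetic costs the bit lengths of its
operands. A Turing machine simulates a program with polynomial overhead. All loops run through a
list, so that every program terminates. -/

/-- Values. The list `[a, b, …]` is `pair a (pair b …)`, ending in `num 0`. -/
inductive Val : Type
  | num (k : ℕ) : Val
  | pair (a b : Val) : Val

namespace Val

/-- Length of a value as an input, with numbers in binary. -/
def size : Val → ℕ
  | num k => 1 + k.size
  | pair a b => 1 + a.size + b.size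

def ofList : List Val → Val
  | [] => num 0
  | a :: l => pair a (ofList l)

def toNum : Val → ℕ
  | num k => k
  | pair _ _ => 0

def fst : Val → Val
  | num _ => num 0
  | pair a _ => a

def snd : Val → Val
  | num _ => num 0
  | pair _ b => b

def isPair : Val → Val
  | num _ => num 0
  | pair _ _ => num 1

end Val

inductive ArithOp : Type
  | add | sub | mul | div | lt | eq

def ArithOp.apply : ArithOp → ℕ → ℕ → ℕ
  | add, a, b => a + b
  | sub, a, b => a - b
  | mul, a, b => a * b
  | div, a, b => a / b
  | lt, a, b => if a < b then 1 else 0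
  | eq, a, b => if a = b then 1 else 0

inductive PExpr : Type
  | var (x : ℕ) : PExpr
  | const (k : ℕ) : PExpr
  | pair (e f : PExpr) : PExpr
  | fst (e : PExpr) : PExpr
  | snd (e : PExpr) : PExpr
  | isPair (e : PExpr) : PExpr
  | arith (o : ArithOp) (e f : PExpr) : PExpr

/-- The contents of the variables. -/
abbrev Store : Type := ℕ → Val

namespace PExpr

def eval (σ : Store) : PExpr → Val
  | var x => σ x
  | const k => Val.num k
  | pair e f => Val.pair (e.eval σ) (f.eval σ)
  | fst e => (e.eval σ).fst
  | snd e => (e.eval σ).snd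
  | isPair e => (e.eval σ).isPair
  | arith o e f => Val.num (o.apply (e.eval σ).toNum (f.eval σ).toNum)

def cost (σ : Store) : PExpr → ℕ
  | var _ => 1
  | const k => 1 + k.size
  | pair e f => 1 + e.cost σ + f.cost σ
  | fst e => 1 + e.cost σ
  | snd e => 1 + e.cost σ
  | isPair e => 1 + e.cost σ
  | arith _ e f =>
      1 + e.cost σ + f.cost σ + (e.eval σ).toNum.size + (f.eval σ).toNum.size

end PExpr

inductive Prog : Type
  | skip : Prog
  | assign (x : ℕ) (e : PExpr) : Prog
  | seq (c d : Prog) : Prog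
  | ite (e : PExpr) (c d : Prog) : Prog
  | forEach (x : ℕ) (e : PExpr) (c : Prog) : Prog

namespace Prog

/-- Runs `body` once for every entry of a list, with the entry in the variable `x`. -/
def loop (body : Store → Store × ℕ) (x : ℕ) : Val → Store → Store × ℕ
  | Val.num _, σ => (σ, 1)
  | Val.pair a b, σ =>
      let r := body (Function.update σ x a)
      let r' := loop body x b r.1
      (r'.1, 1 + r.2 + r'.2)

/-- The final store and the number of steps. -/
def run : Prog → Store → Store × ℕ
  | skip, σ => (σ, 1)
  | assign x e, σ => (Function.update σ x (e.eval σ), 1 + e.cost σ)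
  | seq c d, σ =>
      let r := c.run σ
      let r' := d.run r.1
      (r'.1, r.2 + r'.2)
  | ite e c d, σ =>
      let r := if (e.eval σ).toNum ≠ 0 then c.run σ else d.run σ
      (r.1, 1 + e.cost σ + r.2)
  | forEach x e c, σ =>
      let r := loop c.run x (e.eval σ) σ
      (r.1, 1 + e.cost σ + r.2)

/-- The input is in variable 0, a list of random bits in variable 1, all else is `0`. -/
def initStore (input : Val) {k : ℕ} (bits : Fin k → Bool) : Store := fun x =>
  if x = 0 then input
  else if x = 1 then Val.ofList ((List.ofFn bits).map fun b => Val.num b.toNat)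
  else Val.num 0

/-- The output is read off variable 0. -/
def output (P : Prog) (input : Val) {k : ℕ} (bits : Fin k → Bool) : Val :=
  (P.run (initStore input bits)).1 0

/-- The running time. -/
def time (P : Prog) (input : Val) {k : ℕ} (bits : Fin k → Bool) : ℕ :=
  (P.run (initStore input bits)).2

end Prog

/-- The probability of an event for `k` fair coins. -/
noncomputable def coinProb {k : ℕ} (A : Set (Fin k → Bool)) : ℝ :=
  (A.ncard : ℝ) / 2 ^ k

namespace ECSInstance

/-- The encoding of an instance whose influence strengths are the rationals `q`: the list of the
score vectors, the list of the edges `(u, v)` with numerator and denominator of `q (u, v)`, and the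
budget. -/
def encode (I : ECSInstance) (q : I.Voter × I.Voter → ℚ) : Val :=
  Val.ofList
    [ Val.ofList ((List.finRange I.n).map fun v =>
        Val.ofList ((List.finRange (I.ℓ + 1)).map fun c => Val.num (I.score v c))),
      Val.ofList ((((List.finRange I.n).product (List.finRange I.n)).filter
        fun e => decide (e ∈ I.E)).map fun e =>
          Val.ofList [Val.num e.1, Val.num e.2, Val.num (q e).num.toNat, Val.num (q e).den]),
      Val.num I.B ]

/-- The input of a randomized algorithm: the encoded instance with a confidence parameter `k` in
unary. -/
def encodeInput (I : ECSInstance) (q : I.Voter × I.Voter → ℚ) (k : ℕ) : Val :=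
  Val.pair (I.encode q) (Val.ofList (List.replicate k (Val.num 0)))

/-- The encoding of a plan; an integer `z` is the pair of `max z 0` and `max (-z) 0`. -/
def encodePlan {I : ECSInstance} (L : I.Plan) : Val :=
  Val.ofList (L.map fun sm =>
    Val.pair (Val.num sm.1)
      (Val.ofList ((List.finRange (I.ℓ + 1)).map fun c =>
        Val.pair (Val.num (sm.2 c).toNat) (Val.num (-sm.2 c).toNat))))

end ECSInstance

/-!
Only the voters that do not rank `c_0` first can be won for it, and `δ` articles on `c_0` win every
such voter that they reach. Let `expCover T` be the expected number of these voters that the set `T`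
of seeds reaches. The plan that sends `δ` articles from every seed of `S` therefore gains at least
`expCover S`, whereas an arbitrary plan gains at most `2 * expCover T`, where `T` is the set of its
seeds that send anything: every voter that is reached adds at most one vote to `c_0` and takes at
most one from the strongest competitor. Since `expCover` is monotone and submodular, the greedy
choice of `K = min ⌊B / δ⌋ n` seeds attains a fraction `1 - (1 - 1 / D) ^ K` of the value of any
`D = min B n` seeds, and this exceeds `K / D * (1 - 1 / e) ≥ 2 * ρ` by at least `1 / (9 * D ^ 2)`.

That surplus pays for sampling. The randomized algorithm runs greedy on the mean coverage over
polynomially many sampled live graphs, which by Hoeffding's inequality and a union bound over the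
seed sets is within `1 / (18 * n ^ 2)` of `expCover` with probability at least `1 - 1 / 2 ^ k`.
Every sampled graph has positive probability, so a step that increases the sampled coverage also
increases `expCover`, whether or not the samples are accurate.
-/

/-- A normalized monotone submodular set function, as maximized by greedy algorithms. -/
structure IsMonotoneSubmodular {α : Type*} [DecidableEq α] (F : Finset α → ℝ) : Prop where
  empty : F ∅ = 0
  mono : Monotone F
  union_add_inter_le : ∀ S T, F (S ∪ T) + F (S ∩ T) ≤ F S + F T

/-- `GreedyReachable F K S` states that the greedy algorithm for the maximization of `F` can arrive
at `S` in `K` rounds, each of which gains at least as much as every single element does. A round is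
not required to add just one element, so that leaving the set alone when no element increases `F`
counts as a round. -/
inductive GreedyReachable {α : Type*} [DecidableEq α] (F : Finset α → ℝ) : ℕ → Finset α → Prop
  | zero : GreedyReachable F 0 ∅
  | succ {K : ℕ} {S S' : Finset α} : GreedyReachable F K S → F S ≤ F S' →
      (∀ t, F (insert t S) ≤ F S') → GreedyReachable F (K + 1) S'

theorem toFinset_append_singleton {α : Type*} [DecidableEq α] (S : List α) (s : α) :
    (S ++ [s]).toFinset = insert s S.toFinset := by
  ext x; simp

namespace IsMonotoneSubmodular

variable {α : Type*} [DecidableEq α] {F : Finset α → ℝ}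

theorem card_biUnion {β : Type*} [DecidableEq β] (A : α → Finset β) :
    IsMonotoneSubmodular fun S => ((S.biUnion A).card : ℝ) where
  empty := by simp
  mono _ _ h := Nat.cast_le.2 <| Finset.card_le_card <|
    Finset.biUnion_subset_biUnion_of_subset_left A h
  union_add_inter_le S T := by
    rw [Finset.union_biUnion]
    have hinter : (S ∩ T).biUnion A ⊆ S.biUnion A ∩ T.biUnion A :=
      Finset.subset_inter (Finset.biUnion_subset_biUnion_of_subset_left A Finset.inter_subset_left)
        (Finset.biUnion_subset_biUnion_of_subset_left A Finset.inter_subset_right)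
    have hcard := Finset.card_union_add_card_inter (S.biUnion A) (T.biUnion A)
    exact_mod_cast hcard ▸ Nat.add_le_add_left (Finset.card_le_card hinter) _

theorem sum_mul {ι : Type*} {s : Finset ι} {w : ι → ℝ} {G : ι → Finset α → ℝ}
    (hw : ∀ i ∈ s, 0 ≤ w i) (hG : ∀ i ∈ s, IsMonotoneSubmodular (G i)) :
    IsMonotoneSubmodular fun S => ∑ i ∈ s, w i * G i S where
  empty := Finset.sum_eq_zero fun i hi => by rw [(hG i hi).empty, mul_zero]
  mono _ _ h := Finset.sum_le_sum fun i hi => mul_le_mul_of_nonneg_left ((hG i hi).mono h) (hw i hi)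
  union_add_inter_le S T := by
    simp only [← Finset.sum_add_distrib, ← mul_add]
    exact Finset.sum_le_sum fun i hi =>
      mul_le_mul_of_nonneg_left ((hG i hi).union_add_inter_le S T) (hw i hi)

theorem nonneg (hF : IsMonotoneSubmodular F) (S : Finset α) : 0 ≤ F S :=
  hF.empty ▸ hF.mono (Finset.empty_subset S)

theorem union_le_add_sum (hF : IsMonotoneSubmodular F) (S T : Finset α) :
    F (S ∪ T) ≤ F S + ∑ t ∈ T, (F (insert t S) - F S) := by
  induction T using Finset.induction_on with
  | empty => simp
  | insert t T ht ih =>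
    have hunion : (S ∪ T) ∪ insert t S = S ∪ insert t T := by grind
    have hinter : F S ≤ F ((S ∪ T) ∩ insert t S) := hF.mono (by grind)
    have hsub := hF.union_add_inter_le (S ∪ T) (insert t S)
    rw [hunion] at hsub
    rw [Finset.sum_insert ht]
    linarith

theorem gap_step (hF : IsMonotoneSubmodular F) {S T : Finset α} {D : ℕ} (hD : 0 < D)
    (hT : T.card ≤ D) {x : ℝ} (hS : F S ≤ x) (hx : ∀ t, F (insert t S) ≤ x) :
    F T - x ≤ (1 - 1 / (D : ℝ)) * (F T - F S) := by
  have hgains : F T - F S ≤ D * (x - F S) := by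
    calc F T - F S ≤ F (S ∪ T) - F S := sub_le_sub_right (hF.mono Finset.subset_union_right) _
      _ ≤ ∑ t ∈ T, (F (insert t S) - F S) := sub_le_iff_le_add'.2 (hF.union_le_add_sum S T)
      _ ≤ ∑ _t ∈ T, (x - F S) := Finset.sum_le_sum fun t _ => sub_le_sub_right (hx t) _
      _ = T.card * (x - F S) := by rw [Finset.sum_const, nsmul_eq_mul]
      _ ≤ D * (x - F S) := by gcongr
  have hstep : (F T - F S) / D ≤ x - F S := by
    rwa [div_le_iff₀' (Nat.cast_pos.2 hD)]
  calc F T - x = (F T - F S) - (x - F S) := by ring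
    _ ≤ (F T - F S) - (F T - F S) / D := sub_le_sub_left hstep _
    _ = (1 - 1 / (D : ℝ)) * (F T - F S) := by ring

/-- The theorem of Nemhauser, Wolsey and Fisher, with `K` rounds against `D` elements. -/
theorem le_of_greedyReachable (hF : IsMonotoneSubmodular F) {K : ℕ} {S : Finset α}
    (hS : GreedyReachable F K S) {T : Finset α} {D : ℕ} (hD : 0 < D) (hT : T.card ≤ D) :
    (1 - (1 - 1 / (D : ℝ)) ^ K) * F T ≤ F S := by
  suffices hgap : F T - F S ≤ (1 - 1 / (D : ℝ)) ^ K * F T by linarith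
  have hq : (0 : ℝ) ≤ 1 - 1 / D := sub_nonneg.2 (div_le_one_of_le₀ (by exact_mod_cast hD) (by simp))
  induction hS with
  | zero => simp [hF.empty]
  | succ _ hSS' hmax ih =>
    rw [pow_succ', mul_assoc]
    exact (hF.gap_step hD hT hSS' hmax).trans (by gcongr)

end IsMonotoneSubmodular

theorem one_sub_le_exp_neg_sub_sq_div_two {x : ℝ} (h0 : 0 ≤ x) (h1 : x ≤ 1) :
    1 - x ≤ Real.exp (-x - x ^ 2 / 2) := by
  rcases h1.eq_or_lt with rfl | h1
  · simpa using (Real.exp_pos _).le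
  have hlog : x + x ^ 2 / 2 ≤ -Real.log (1 - x) := by
    have hsum := Real.hasSum_pow_div_log_of_abs_lt_one (x := x) (by rwa [abs_of_nonneg h0])
    have hle := sum_le_hasSum (Finset.range 2) (fun i _ => by positivity) hsum
    norm_num [Finset.sum_range_succ] at hle
    exact hle
  rw [← Real.log_le_iff_le_exp (sub_pos.2 h1)]
  linarith

theorem one_sub_one_div_pow_le {D : ℕ} (hD : 0 < D) :
    (1 - 1 / (D : ℝ)) ^ D ≤ 1 / Real.exp 1 - 1 / (9 * D) := by
  have hD' : (1 : ℝ) ≤ D := by exact_mod_cast hD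
  have hx : 1 / (D : ℝ) ≤ 1 := div_le_one_of_le₀ hD' (by simp)
  have hexp : Real.exp (-(1 / (2 * D : ℝ))) ≤ 1 - 1 / (3 * D) := by
    calc Real.exp (-(1 / (2 * D : ℝ))) ≤ 1 / (1 + 1 / (2 * D)) := by
          rw [Real.exp_neg, ← one_div]
          gcongr
          linarith [Real.add_one_le_exp (1 / (2 * D : ℝ))]
      _ ≤ 1 - 1 / (3 * D) := by
          rw [div_le_iff₀ (by positivity)]
          field_simp
          linarith
  have he : (1 : ℝ) / 3 ≤ 1 / Real.exp 1 := by
    gcongr; exact Real.exp_one_lt_three.le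
  calc (1 - 1 / (D : ℝ)) ^ D ≤ Real.exp (-(1 / (D : ℝ)) - (1 / (D : ℝ)) ^ 2 / 2) ^ D :=
        pow_le_pow_left₀ (sub_nonneg.2 hx) (one_sub_le_exp_neg_sub_sq_div_two (by positivity) hx) D
    _ = 1 / Real.exp 1 * Real.exp (-(1 / (2 * D))) := by
        rw [← Real.exp_nat_mul, one_div (Real.exp 1), ← Real.exp_neg, ← Real.exp_add]
        congr 1; field_simp; ring
    _ ≤ 1 / Real.exp 1 * (1 - 1 / (3 * D)) := by gcongr
    _ = 1 / Real.exp 1 - 1 / Real.exp 1 * (1 / (3 * D)) := by ring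
    _ ≤ 1 / Real.exp 1 - 1 / 3 * (1 / (3 * D)) := by gcongr
    _ = 1 / Real.exp 1 - 1 / (9 * D) := by ring

theorem div_mul_one_sub_pow_le {q : ℝ} (hq : 0 ≤ q) {K D : ℕ} (hKD : K ≤ D) :
    (K : ℝ) / D * (1 - q ^ D) ≤ 1 - q ^ K := by
  rcases D.eq_zero_or_pos with rfl | hD
  · simp [Nat.le_zero.1 hKD]
  have hD' : (D : ℝ) ≠ 0 := by positivity
  have hbernoulli : (1 + (q ^ D - 1)) ^ (K / D : ℝ) ≤ 1 + K / D * (q ^ D - 1) :=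
    rpow_one_add_le_one_add_mul_self (by linarith [pow_nonneg hq D]) (by positivity)
      (div_le_one_of_le₀ (by exact_mod_cast hKD) (by positivity))
  have hroot : (1 + (q ^ D - 1)) ^ (K / D : ℝ) = q ^ K := by
    rw [add_sub_cancel, ← Real.rpow_natCast_mul hq, mul_div_cancel₀ _ hD', Real.rpow_natCast]
  rw [hroot] at hbernoulli
  linarith

-- The margin `1 / (9 D²)` over the factor needed in the end leaves room for sampling errors.
theorem div_mul_one_sub_one_div_exp_add_le {K D : ℕ} (hK : 0 < K) (hKD : K ≤ D) :
    (K : ℝ) / D * (1 - 1 / Real.exp 1) + 1 / (9 * (D : ℝ) ^ 2) ≤ 1 - (1 - 1 / (D : ℝ)) ^ K := by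
  have hD : 0 < D := hK.trans_le hKD
  have hD' : (1 : ℝ) ≤ D := by exact_mod_cast hD
  have hK' : (1 : ℝ) ≤ K := by exact_mod_cast hK
  have hq : 0 ≤ 1 - 1 / (D : ℝ) := sub_nonneg.2 (div_le_one_of_le₀ hD' (by simp))
  calc (K : ℝ) / D * (1 - 1 / Real.exp 1) + 1 / (9 * (D : ℝ) ^ 2)
      = K / D * (1 - 1 / Real.exp 1) + 1 / D * (1 / (9 * D)) := by ring
    _ ≤ K / D * (1 - 1 / Real.exp 1) + K / D * (1 / (9 * D)) := by gcongr
    _ = K / D * (1 - (1 / Real.exp 1 - 1 / (9 * D))) := by ring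
    _ ≤ K / D * (1 - (1 - 1 / (D : ℝ)) ^ D) := by gcongr; exact one_sub_one_div_pow_le hD
    _ ≤ 1 - (1 - 1 / (D : ℝ)) ^ K := div_mul_one_sub_pow_le hq hKD

section RandomSubset

variable {κ : Type*} [DecidableEq κ]

/-- The probability that a random subset of `s`, which contains each `e` independently with
probability `p e`, is `H`. -/
noncomputable def subsetProb (p : κ → ℝ) (s H : Finset κ) : ℝ :=
  (∏ e ∈ H, p e) * ∏ e ∈ s \ H, (1 - p e)

/-- The expectation of `g` at the random subset of `s` with the law `subsetProb p s`. -/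
noncomputable def subsetExpect (p : κ → ℝ) (s : Finset κ) (g : Finset κ → ℝ) : ℝ :=
  ∑ H ∈ s.powerset, subsetProb p s H * g H

variable {p q : κ → ℝ} {s : Finset κ}

theorem subsetProb_nonneg (hp : ∀ e ∈ s, p e ∈ Set.Icc (0 : ℝ) 1) {H : Finset κ} (hH : H ⊆ s) :
    0 ≤ subsetProb p s H :=
  mul_nonneg (Finset.prod_nonneg fun e he => (hp e (hH he)).1)
    (Finset.prod_nonneg fun e he => sub_nonneg.2 (hp e (Finset.mem_sdiff.1 he).1).2)

theorem subsetExpect_const (p : κ → ℝ) (s : Finset κ) (c : ℝ) :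
    subsetExpect p s (fun _ => c) = c := by
  have hsum : ∑ H ∈ s.powerset, subsetProb p s H = 1 := by
    simpa [subsetProb] using (Finset.prod_add p (fun e => 1 - p e) s).symm
  rw [subsetExpect, ← Finset.sum_mul, hsum, one_mul]

theorem subsetExpect_add (p : κ → ℝ) (s : Finset κ) (f g : Finset κ → ℝ) :
    subsetExpect p s (fun H => f H + g H) = subsetExpect p s f + subsetExpect p s g := by
  simp only [subsetExpect, mul_add, Finset.sum_add_distrib]

theorem subsetExpect_const_mul (p : κ → ℝ) (s : Finset κ) (c : ℝ) (g : Finset κ → ℝ) :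
    subsetExpect p s (fun H => c * g H) = c * subsetExpect p s g := by
  simp only [subsetExpect, Finset.mul_sum, mul_left_comm]

theorem subsetExpect_mono (hp : ∀ e ∈ s, p e ∈ Set.Icc (0 : ℝ) 1) {f g : Finset κ → ℝ}
    (h : ∀ H ⊆ s, f H ≤ g H) : subsetExpect p s f ≤ subsetExpect p s g :=
  Finset.sum_le_sum fun H hH => mul_le_mul_of_nonneg_left (h H (Finset.mem_powerset.1 hH))
    (subsetProb_nonneg hp (Finset.mem_powerset.1 hH))

theorem subsetExpect_mem_Icc (hp : ∀ e ∈ s, p e ∈ Set.Icc (0 : ℝ) 1) {a b : ℝ}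
    {g : Finset κ → ℝ} (hg : ∀ H, g H ∈ Set.Icc a b) : subsetExpect p s g ∈ Set.Icc a b :=
  ⟨(subsetExpect_const p s a).symm.trans_le (subsetExpect_mono hp fun H _ => (hg H).1),
    (subsetExpect_mono hp fun H _ => (hg H).2).trans_eq (subsetExpect_const p s b)⟩

theorem subsetExpect_insert (p : κ → ℝ) {a : κ} (ha : a ∉ s) (g : Finset κ → ℝ) :
    subsetExpect p (insert a s) g =
      (1 - p a) * subsetExpect p s g + p a * subsetExpect p s fun H => g (insert a H) := by
  rw [subsetExpect, Finset.sum_powerset_insert ha, subsetExpect, subsetExpect, Finset.mul_sum,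
    Finset.mul_sum]
  congr 1 <;> refine Finset.sum_congr rfl fun H hH => ?_ <;>
    have haH : a ∉ H := fun h => ha (Finset.mem_powerset.1 hH h)
  · rw [subsetProb, subsetProb, Finset.insert_sdiff_of_notMem _ haH,
      Finset.prod_insert (by simp [ha])]
    ring
  · rw [subsetProb, subsetProb, Finset.insert_sdiff_insert, Finset.sdiff_insert_of_notMem ha,
      Finset.prod_insert haH]
    ring

theorem abs_subsetExpect_sub_le (hp : ∀ e ∈ s, p e ∈ Set.Icc (0 : ℝ) 1)
    (hq : ∀ e ∈ s, q e ∈ Set.Icc (0 : ℝ) 1) {M : ℝ} {g : Finset κ → ℝ}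
    (hg : ∀ H, g H ∈ Set.Icc 0 M) :
    |subsetExpect p s g - subsetExpect q s g| ≤ (∑ e ∈ s, |p e - q e|) * M := by
  induction s using Finset.induction_on generalizing g with
  | empty => simp [subsetExpect, subsetProb]
  | insert a s ha ih =>
    have hp' : ∀ e ∈ s, p e ∈ Set.Icc (0 : ℝ) 1 := fun e he => hp e (Finset.mem_insert_of_mem he)
    have hq' : ∀ e ∈ s, q e ∈ Set.Icc (0 : ℝ) 1 := fun e he => hq e (Finset.mem_insert_of_mem he)
    obtain ⟨hpa0, hpa1⟩ := hp a (Finset.mem_insert_self a s)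
    have hg' : ∀ H, g (insert a H) ∈ Set.Icc 0 M := fun H => hg _
    rw [subsetExpect_insert p ha, subsetExpect_insert q ha, Finset.sum_insert ha]
    set x := subsetExpect p s g
    set x' := subsetExpect p s fun H => g (insert a H)
    set y := subsetExpect q s g
    set y' := subsetExpect q s fun H => g (insert a H)
    have hdiff : |y' - y| ≤ M := by
      have hy := subsetExpect_mem_Icc hq' hg
      have hy' := subsetExpect_mem_Icc hq' hg'
      exact abs_sub_le_of_le_of_le hy'.1 hy'.2 hy.1 hy.2 |>.trans_eq (sub_zero M)
    calc |(1 - p a) * x + p a * x' - ((1 - q a) * y + q a * y')|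
        = |(1 - p a) * (x - y) + p a * (x' - y') + (p a - q a) * (y' - y)| := by congr 1; ring
      _ ≤ |(1 - p a) * (x - y)| + |p a * (x' - y')| + |(p a - q a) * (y' - y)| :=
          abs_add_three _ _ _
      _ = (1 - p a) * |x - y| + p a * |x' - y'| + |p a - q a| * |y' - y| := by
          rw [abs_mul, abs_mul, abs_mul, abs_of_nonneg (sub_nonneg.2 hpa1), abs_of_nonneg hpa0]
      _ ≤ (1 - p a) * ((∑ e ∈ s, |p e - q e|) * M) + p a * ((∑ e ∈ s, |p e - q e|) * M) +
            |p a - q a| * M := by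
          gcongr
          · exact ih hp' hq' hg
          · exact ih hp' hq' hg'
      _ = (|p a - q a| + ∑ e ∈ s, |p e - q e|) * M := by ring

end RandomSubset

namespace ECSInstance

/-- The voters that do not rank `c_0` first before the diffusion, the only ones whose vote a message
in favor of `c_0` can change. -/
def opposed (I : ECSInstance) : Finset I.Voter :=
  Finset.univ.filter fun v => ∃ d, I.score v 0 < I.score v d

open Classical in
/-- The opposed voters that the message of some member of `T` activates. -/
noncomputable def covered (I : ECSInstance) (H : Finset (I.Voter × I.Voter))
    (T : Finset I.Voter) : Finset I.Voter :=
  T.biUnion fun s => I.opposed.filter (Influenced H s)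

/-- The expected number of covered voters: the monotone submodular function that is maximized. -/
noncomputable def expCover (I : ECSInstance) (T : Finset I.Voter) : ℝ :=
  I.expect fun H => ((I.covered H T).card : ℝ)

/-- The seeds that send at least one article. -/
def activeSeeds {I : ECSInstance} (L : I.Plan) : Finset I.Voter :=
  ((L.filter fun sm => sm.2 ≠ 0).map Prod.fst).toFinset

/-- The number of seeds of the greedy algorithm. -/
def seedCount (I : ECSInstance) : ℕ := min (I.B / I.delta.toNat) I.n

/-- A bound on the number of active seeds of a feasible plan. -/
def maxSeeds (I : ECSInstance) : ℕ := min I.B I.n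

variable {I : ECSInstance}

theorem p_mem_Icc (I : ECSInstance) (e : I.Voter × I.Voter) : I.p e ∈ Set.Icc (0 : ℝ) 1 :=
  ⟨I.p_nonneg e, I.p_le_one e⟩

theorem expect_eq_subsetExpect (I : ECSInstance) (f : Finset (I.Voter × I.Voter) → ℝ) :
    I.expect f = subsetExpect I.p I.E f := rfl

theorem expect_mono {f g : Finset (I.Voter × I.Voter) → ℝ} (h : ∀ H, f H ≤ g H) :
    I.expect f ≤ I.expect g :=
  subsetExpect_mono (fun e _ => I.p_mem_Icc e) fun H _ => h H

theorem mem_opposed {v : I.Voter} : v ∈ I.opposed ↔ ∃ d, I.score v 0 < I.score v d := by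
  simp [opposed]

theorem mem_covered {H : Finset (I.Voter × I.Voter)} {T : Finset I.Voter} {v : I.Voter} :
    v ∈ I.covered H T ↔ v ∈ I.opposed ∧ ∃ s ∈ T, Influenced H s v := by
  simp only [covered, Finset.mem_biUnion, Finset.mem_filter]
  grind

theorem isMonotoneSubmodular_card_covered (H : Finset (I.Voter × I.Voter)) :
    IsMonotoneSubmodular fun T => ((I.covered H T).card : ℝ) :=
  IsMonotoneSubmodular.card_biUnion _

theorem isMonotoneSubmodular_expCover (I : ECSInstance) : IsMonotoneSubmodular I.expCover :=
  IsMonotoneSubmodular.sum_mul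
    (fun _ hH => subsetProb_nonneg (fun e _ => I.p_mem_Icc e) (Finset.mem_powerset.1 hH))
    fun H _ => isMonotoneSubmodular_card_covered H

theorem perturbation_pos (I : ECSInstance) : 0 < I.perturbation := by
  unfold perturbation; positivity

theorem perturbation_lt_one (I : ECSInstance) : I.perturbation < 1 := by
  obtain ⟨v, c, hc⟩ : ∃ v c, 0 < I.score v c := by
    by_contra! h
    have hzero : ∀ c, I.score ⟨0, I.n_pos⟩ c = 0 := fun c => Nat.le_zero.1 (h _ c)
    have hlast := I.score_injective _ ((hzero 0).trans (hzero (Fin.last I.ℓ)).symm)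
    exact I.ℓ_pos.ne (congrArg Fin.val hlast)
  have hsup : 0 < Finset.univ.sup fun v => Finset.univ.sup fun c => I.score v c :=
    (hc.trans_le (Finset.le_sup (Finset.mem_univ c))).trans_le
      (Finset.le_sup (f := fun v => Finset.univ.sup fun c => I.score v c) (Finset.mem_univ v))
  rw [perturbation, div_lt_one (by positivity), lt_add_iff_pos_right]
  exact_mod_cast hsup

theorem mem_supporters {L : I.Plan} {H : Finset (I.Voter × I.Voter)} {c : I.Candidate}
    {v : I.Voter} :
    v ∈ I.supporters L H c ↔ ∀ d, d ≠ c → I.finalScore L H v d < I.finalScore L H v c := by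
  simp [supporters]

theorem finalScore_nil (H : Finset (I.Voter × I.Voter)) (v : I.Voter) (c : I.Candidate) :
    I.finalScore [] H v c = (1 - I.perturbation) * I.score v c := by
  simp [finalScore]

theorem mem_supporters_nil {H : Finset (I.Voter × I.Voter)} {c : I.Candidate} {v : I.Voter} :
    v ∈ I.supporters [] H c ↔ ∀ d, d ≠ c → I.score v d < I.score v c := by
  simp only [mem_supporters, finalScore_nil, Nat.cast_lt,
    mul_lt_mul_iff_right₀ (sub_pos.2 I.perturbation_lt_one)]

theorem supporters_nil_zero (H : Finset (I.Voter × I.Voter)) :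
    I.supporters [] H 0 = I.opposedᶜ := by
  ext v
  simp only [mem_supporters_nil, Finset.mem_compl, mem_opposed, not_exists, not_lt]
  refine ⟨fun h d => ?_, fun h d hd => (h d).lt_of_ne fun e => hd (I.score_injective v e)⟩
  rcases eq_or_ne d 0 with rfl | hd
  exacts [le_rfl, (h d hd).le]

theorem supporters_nil_subset_opposed (H : Finset (I.Voter × I.Voter)) {c : I.Candidate}
    (hc : c ≠ 0) : I.supporters [] H c ⊆ I.opposed := fun _ hv =>
  mem_opposed.2 ⟨c, mem_supporters_nil.1 hv 0 hc.symm⟩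

theorem score_sub_score_zero_le_delta (v : I.Voter) {c : I.Candidate} (hc : c ≠ 0) :
    (I.score v c : ℤ) - I.score v 0 ≤ I.delta :=
  Finset.le_sup' (fun x : I.Voter × I.Candidate => (I.score x.1 x.2 : ℤ) - (I.score x.1 0 : ℤ))
    (b := (v, c)) (by simp [hc])

theorem finalScore_deltaPlan_of_ne (S : List I.Voter) (H : Finset (I.Voter × I.Voter))
    (v : I.Voter) {c : I.Candidate} (hc : c ≠ 0) :
    I.finalScore (I.deltaPlan S) H v c = I.finalScore [] H v c := by
  simp [finalScore, deltaPlan, Function.comp_def, hc]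

open Classical in
theorem finalScore_deltaPlan_zero (S : List I.Voter) (H : Finset (I.Voter × I.Voter))
    (v : I.Voter) : I.finalScore (I.deltaPlan S) H v 0 =
      I.finalScore [] H v 0 + S.countP (Influenced H · v) * I.delta := by
  rw [finalScore_nil, finalScore, add_right_inj]
  induction S with
  | nil => simp [deltaPlan]
  | cons s S ih =>
    rw [deltaPlan, List.map_cons, List.map_cons, List.sum_cons, ← deltaPlan, ih]
    by_cases h : Influenced H s v <;> simp [h, add_mul, add_comm]

theorem mem_supporters_deltaPlan_of_influenced (hδ : 0 < I.delta) {S : List I.Voter}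
    {H : Finset (I.Voter × I.Voter)} {v s : I.Voter} (hs : s ∈ S) (hv : Influenced H s v) :
    v ∈ I.supporters (I.deltaPlan S) H 0 := by
  classical
  refine mem_supporters.2 fun d hd => ?_
  rw [finalScore_deltaPlan_of_ne S H v hd, finalScore_deltaPlan_zero, finalScore_nil,
    finalScore_nil]
  set j := S.countP (Influenced H · v)
  have : (0 : ℚ) < I.delta := by exact_mod_cast hδ
  have hj : (1 : ℚ) ≤ j := by
    exact_mod_cast List.countP_pos_iff.2 ⟨s, hs, decide_eq_true hv⟩
  have hexcess : (I.score v d : ℚ) - I.score v 0 ≤ I.delta := by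
    exact_mod_cast score_sub_score_zero_le_delta v hd
  have hlt : (1 - I.perturbation) * ((I.score v d : ℚ) - I.score v 0) < j * I.delta := by
    calc (1 - I.perturbation) * ((I.score v d : ℚ) - I.score v 0)
        ≤ (1 - I.perturbation) * I.delta := by
          gcongr; exact (sub_pos.2 I.perturbation_lt_one).le
      _ < 1 * I.delta := by gcongr; linarith [I.perturbation_pos]
      _ ≤ j * I.delta := by gcongr
  linarith

theorem supporters_deltaPlan_zero (hδ : 0 < I.delta) (S : List I.Voter)
    (H : Finset (I.Voter × I.Voter)) :
    I.supporters (I.deltaPlan S) H 0 = I.opposedᶜ ∪ I.covered H S.toFinset := by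
  classical
  ext v
  by_cases h : ∃ s ∈ S, Influenced H s v
  · obtain ⟨s, hs, hi⟩ := h
    have hv := mem_supporters_deltaPlan_of_influenced hδ hs hi
    simp only [hv, Finset.mem_union, Finset.mem_compl, mem_covered, List.mem_toFinset, true_iff]
    exact (em' _).imp_right fun ho => ⟨ho, s, hs, hi⟩
  · have hcount : S.countP (Influenced H · v) = 0 := by simpa [List.countP_eq_zero] using h
    have hscore : ∀ c, I.finalScore (I.deltaPlan S) H v c = I.finalScore [] H v c := by
      intro c
      rcases eq_or_ne c 0 with rfl | hc
      · simp [finalScore_deltaPlan_zero, hcount]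
      · exact finalScore_deltaPlan_of_ne S H v hc
    simp [mem_supporters, hscore, ← supporters_nil_zero H, mem_covered, h]

theorem card_supporters_deltaPlan_zero (hδ : 0 < I.delta) (S : List I.Voter)
    (H : Finset (I.Voter × I.Voter)) :
    (I.supporters (I.deltaPlan S) H 0).card =
      I.opposedᶜ.card + (I.covered H S.toFinset).card := by
  rw [supporters_deltaPlan_zero hδ, Finset.card_union_of_disjoint]
  exact Finset.disjoint_left.2 fun v hv hv' => Finset.mem_compl.1 hv (mem_covered.1 hv').1

theorem expVotes_deltaPlan (hδ : 0 < I.delta) (S : List I.Voter) :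
    I.expVotes (I.deltaPlan S) = I.opposedᶜ.card + I.expCover S.toFinset := by
  simp only [expVotes, card_supporters_deltaPlan_zero hδ, Nat.cast_add, expect_eq_subsetExpect,
    subsetExpect_add, subsetExpect_const, expCover]

theorem supporters_deltaPlan_subset (hδ : 0 < I.delta) (S : List I.Voter)
    (H : Finset (I.Voter × I.Voter)) {c : I.Candidate} (hc : c ≠ 0) :
    I.supporters (I.deltaPlan S) H c ⊆ I.supporters [] H c := by
  classical
  intro v hv
  rw [mem_supporters] at hv ⊢
  intro d hd
  refine lt_of_le_of_lt ?_ ((hv d hd).trans_eq (finalScore_deltaPlan_of_ne S H v hc))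
  rcases eq_or_ne d 0 with rfl | hd0
  · rw [finalScore_deltaPlan_zero, le_add_iff_nonneg_right]
    have : (0 : ℚ) < I.delta := by exact_mod_cast hδ
    positivity
  · exact (finalScore_deltaPlan_of_ne S H v hd0).ge

theorem expCover_le_expGain_deltaPlan (hδ : 0 < I.delta) (S : List I.Voter) :
    I.expCover S.toFinset ≤ I.expGain (I.deltaPlan S) := by
  refine expect_mono fun H => ?_
  have hopponents : ((Finset.univ.erase (0 : I.Candidate)).sup fun c =>
      (I.supporters (I.deltaPlan S) H c).card) ≤
      (Finset.univ.erase (0 : I.Candidate)).sup fun c => (I.supporters [] H c).card :=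
    Finset.sup_mono_fun fun c hc =>
      Finset.card_le_card (supporters_deltaPlan_subset hδ S H (Finset.ne_of_mem_erase hc))
  have hgain : ((I.covered H S.toFinset).card : ℤ) ≤ I.MoV (I.deltaPlan S) H - I.MoV [] H := by
    rw [MoV, MoV, card_supporters_deltaPlan_zero hδ, supporters_nil_zero]
    omega
  exact_mod_cast hgain

theorem messageSize_pos {m : I.Message} (hm : m ≠ 0) : 0 < messageSize m := by
  obtain ⟨c, hc⟩ := Function.ne_iff.1 hm
  exact Finset.sum_pos' (fun _ _ => Nat.zero_le _) ⟨c, Finset.mem_univ c, Int.natAbs_pos.2 hc⟩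

theorem card_activeSeeds_le_planSize (L : I.Plan) : (activeSeeds L).card ≤ planSize L := by
  calc (activeSeeds L).card ≤ (L.filter fun sm => sm.2 ≠ 0).length :=
        (List.toFinset_card_le _).trans_eq (List.length_map _)
    _ ≤ planSize L := by
      induction L with
      | nil => simp
      | cons sm L ih =>
        have hcons : planSize (sm :: L) = messageSize sm.2 + planSize L := List.sum_cons
        rw [hcons, List.filter_cons]
        split_ifs with h
        · have := messageSize_pos (of_decide_eq_true h)
          rw [List.length_cons]
          omega
        · omega

theorem finalScore_of_not_influenced {L : I.Plan} {H : Finset (I.Voter × I.Voter)} {v : I.Voter}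
    (h : ¬ ∃ s ∈ activeSeeds L, Influenced H s v) (c : I.Candidate) :
    I.finalScore L H v c = I.finalScore [] H v c := by
  rw [finalScore_nil, finalScore, add_eq_left]
  refine List.sum_eq_zero fun x hx => ?_
  obtain ⟨sm, hsm, rfl⟩ := List.mem_map.1 hx
  by_cases hm : sm.2 = 0
  · simp [hm]
  · have hactive : sm.1 ∈ activeSeeds L := by
      simp only [activeSeeds, List.mem_toFinset, List.mem_map, List.mem_filter]
      exact ⟨sm, ⟨hsm, decide_eq_true hm⟩, rfl⟩
    exact if_neg fun hi => h ⟨sm.1, hactive, hi⟩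

theorem mem_supporters_iff_nil {L : I.Plan} {H : Finset (I.Voter × I.Voter)} {v : I.Voter}
    (hv : v ∈ I.opposed) (hv' : v ∉ I.covered H (activeSeeds L)) (c : I.Candidate) :
    v ∈ I.supporters L H c ↔ v ∈ I.supporters [] H c := by
  have h : ¬ ∃ s ∈ activeSeeds L, Influenced H s v := fun hex => hv' (mem_covered.2 ⟨hv, hex⟩)
  simp only [mem_supporters, finalScore_of_not_influenced h]

theorem card_supporters_zero_le (L : I.Plan) (H : Finset (I.Voter × I.Voter)) :
    (I.supporters L H 0).card ≤
      (I.supporters [] H 0).card + (I.covered H (activeSeeds L)).card := by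
  refine (Finset.card_le_card fun v hv => ?_).trans (Finset.card_union_le _ _)
  by_contra! hout
  rw [Finset.mem_union, not_or, supporters_nil_zero, Finset.mem_compl, not_not] at hout
  have hnil := (mem_supporters_iff_nil hout.1 hout.2 0).1 hv
  rw [supporters_nil_zero, Finset.mem_compl] at hnil
  exact hnil hout.1

theorem card_supporters_nil_le (L : I.Plan) (H : Finset (I.Voter × I.Voter)) {c : I.Candidate}
    (hc : c ≠ 0) : (I.supporters [] H c).card ≤
      (I.supporters L H c).card + (I.covered H (activeSeeds L)).card := by
  refine (Finset.card_le_card fun v hv => ?_).trans (Finset.card_union_le _ _)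
  rw [Finset.mem_union, or_iff_not_imp_right]
  exact fun hout =>
    (mem_supporters_iff_nil (supporters_nil_subset_opposed H hc hv) hout c).2 hv

theorem expGain_le_two_mul_expCover (L : I.Plan) :
    I.expGain L ≤ 2 * I.expCover (activeSeeds L) := by
  rw [expCover, expect_eq_subsetExpect, ← subsetExpect_const_mul]
  refine expect_mono fun H => ?_
  have hopponents : ((Finset.univ.erase (0 : I.Candidate)).sup fun c =>
      (I.supporters [] H c).card) ≤
      ((Finset.univ.erase (0 : I.Candidate)).sup fun c => (I.supporters L H c).card) +
        (I.covered H (activeSeeds L)).card :=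
    Finset.sup_le fun c hc => (card_supporters_nil_le L H (Finset.ne_of_mem_erase hc)).trans
      (Nat.add_le_add_right (Finset.le_sup (f := fun c => (I.supporters L H c).card) hc) _)
  have hgain : I.MoV L H - I.MoV [] H ≤ 2 * ((I.covered H (activeSeeds L)).card : ℤ) := by
    have := card_supporters_zero_le L H
    rw [MoV, MoV]
    omega
  exact_mod_cast hgain

end ECSInstance

theorem sub_add_one_div_le_min_div_min {B d n : ℕ} (hd : 0 < d) (hB : 0 < B) (hn : 0 < n) :
    ((B : ℝ) - d + 1) / (d * B) ≤ (min (B / d) n : ℕ) / (min B n : ℕ) := by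
  have hd' : (1 : ℝ) ≤ d := by exact_mod_cast hd
  have : (1 : ℝ) ≤ B := by exact_mod_cast hB
  have : (0 : ℝ) < (min B n : ℕ) := by exact_mod_cast lt_min hB hn
  rcases le_total (B / d) n with h | h
  · have hdiv : (B : ℝ) + 1 ≤ d * (B / d : ℕ) + d := by
      exact_mod_cast Nat.lt_mul_div_succ B hd
    rw [min_eq_left h]
    calc ((B : ℝ) - d + 1) / (d * B) ≤ (d * (B / d : ℕ)) / (d * B) := by gcongr; linarith
      _ = (B / d : ℕ) / B := mul_div_mul_left _ _ (by positivity)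
      _ ≤ (B / d : ℕ) / (min B n : ℕ) := by gcongr; exact min_le_left B n
  · rw [min_eq_right h, min_eq_right (h.trans (Nat.div_le_self _ _)), div_self (by positivity)]
    exact div_le_one_of_le₀ (by nlinarith) (by positivity)

namespace ECSInstance

variable {I : ECSInstance}

theorem seedCount_pos (hδ : 0 < I.delta) (hB : I.delta ≤ I.B) : 0 < I.seedCount :=
  lt_min (Nat.div_pos (by omega) (by omega)) I.n_pos

theorem seedCount_le_maxSeeds (I : ECSInstance) : I.seedCount ≤ I.maxSeeds :=
  min_le_min_right _ (Nat.div_le_self _ _)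

theorem seedCount_mul_delta_le (I : ECSInstance) : I.seedCount * I.delta.toNat ≤ I.B :=
  (Nat.mul_le_mul_right _ (min_le_left _ _)).trans (Nat.div_mul_le_self _ _)

theorem one_sub_one_div_exp_one_nonneg : 0 ≤ 1 - 1 / Real.exp 1 :=
  sub_nonneg.2 (div_le_one_of_le₀ (Real.one_le_exp zero_le_one) (Real.exp_pos 1).le)

theorem ratio_nonneg (hδ : 0 < I.delta) (hB : I.delta ≤ I.B) : 0 ≤ I.ratio := by
  have hB' : (I.delta : ℝ) ≤ I.B := by exact_mod_cast hB
  have : (0 : ℝ) < I.delta := by exact_mod_cast hδ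
  exact mul_nonneg (div_nonneg (by linarith) (by positivity)) one_sub_one_div_exp_one_nonneg

theorem two_mul_ratio_le (hδ : 0 < I.delta) (hB : I.delta ≤ I.B) :
    2 * I.ratio ≤ (I.seedCount : ℝ) / I.maxSeeds * (1 - 1 / Real.exp 1) := by
  have hcast : (I.delta : ℝ) = I.delta.toNat := by exact_mod_cast (Int.toNat_of_nonneg hδ.le).symm
  calc 2 * I.ratio = ((I.B : ℝ) - I.delta + 1) / (I.delta * I.B) * (1 - 1 / Real.exp 1) := by
        rw [ratio, mul_assoc (2 : ℝ), ← div_div _ (2 : ℝ), div_right_comm, ← mul_assoc,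
          mul_div_cancel₀ _ two_ne_zero]
    _ ≤ (I.seedCount : ℝ) / I.maxSeeds * (1 - 1 / Real.exp 1) := by
        rw [hcast]
        exact mul_le_mul_of_nonneg_right
          (sub_add_one_div_le_min_div_min (by omega) (by omega) I.n_pos)
          one_sub_one_div_exp_one_nonneg

theorem maxSeeds_pos (hδ : 0 < I.delta) (hB : I.delta ≤ I.B) : 0 < I.maxSeeds :=
  (seedCount_pos hδ hB).trans_le I.seedCount_le_maxSeeds

theorem two_mul_ratio_add_le (hδ : 0 < I.delta) (hB : I.delta ≤ I.B) {K : ℕ}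
    (hK : I.seedCount ≤ K) :
    2 * I.ratio + 1 / (9 * (I.n : ℝ) ^ 2) ≤ 1 - (1 - 1 / (I.maxSeeds : ℝ)) ^ K := by
  have hD := maxSeeds_pos hδ hB
  have hD' : (1 : ℝ) ≤ I.maxSeeds := Nat.one_le_cast.2 hD
  have hmargin : 1 / (9 * (I.n : ℝ) ^ 2) ≤ 1 / (9 * (I.maxSeeds : ℝ) ^ 2) := by
    gcongr
    exact min_le_right _ _
  have hpow : (1 - 1 / (I.maxSeeds : ℝ)) ^ K ≤ (1 - 1 / (I.maxSeeds : ℝ)) ^ I.seedCount :=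
    pow_le_pow_of_le_one (sub_nonneg.2 (div_le_one_of_le₀ hD' (by positivity)))
      (sub_le_self _ (by positivity)) hK
  linarith [two_mul_ratio_le hδ hB,
    div_mul_one_sub_one_div_exp_add_le (seedCount_pos hδ hB) I.seedCount_le_maxSeeds]

theorem seeds_deltaPlan (S : List I.Voter) : seeds (I.deltaPlan S) = S := by
  simp [seeds, deltaPlan, Function.comp_def]

theorem planSize_deltaPlan (S : List I.Voter) :
    planSize (I.deltaPlan S) = S.length * I.delta.natAbs := by
  have hsize : messageSize (I := I) (Pi.single 0 I.delta) = I.delta.natAbs := by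
    rw [messageSize, Finset.sum_eq_single 0 (fun c _ hc => by simp [hc]) (by simp),
      Pi.single_eq_same]
  simp [planSize, deltaPlan, Function.comp_def, hsize]

theorem feasible_deltaPlan (hδ : 0 < I.delta) {S : List I.Voter} (hS : S.Nodup)
    (hlen : S.length ≤ I.seedCount) : I.Feasible (I.deltaPlan S) := by
  refine ⟨by rwa [seeds_deltaPlan], ?_⟩
  rw [planSize_deltaPlan, ← Int.toNat_of_nonneg hδ.le, Int.natAbs_natCast]
  exact (Nat.mul_le_mul_right _ hlen).trans I.seedCount_mul_delta_le

theorem isApprox_deltaPlan (hδ : 0 < I.delta) (hB : I.delta ≤ I.B) {S : List I.Voter}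
    (hS : S.Nodup) (hlen : S.length ≤ I.seedCount)
    (h : ∀ T : Finset I.Voter, T.card ≤ I.maxSeeds →
      2 * I.ratio * I.expCover T ≤ I.expCover S.toFinset) :
    I.IsApprox I.ratio (I.deltaPlan S) := by
  refine ⟨feasible_deltaPlan hδ hS hlen, fun L hL => ?_⟩
  have hcard : (activeSeeds L).card ≤ I.maxSeeds :=
    le_min ((card_activeSeeds_le_planSize L).trans hL.2) (card_finset_fin_le _)
  calc I.ratio * I.expGain L ≤ I.ratio * (2 * I.expCover (activeSeeds L)) :=
        mul_le_mul_of_nonneg_left (expGain_le_two_mul_expCover L) (ratio_nonneg hδ hB)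
    _ = 2 * I.ratio * I.expCover (activeSeeds L) := by ring
    _ ≤ I.expCover S.toFinset := h _ hcard
    _ ≤ I.expGain (I.deltaPlan S) := expCover_le_expGain_deltaPlan hδ S

theorem GreedySeeds.nodup {S : List I.Voter} (h : I.GreedySeeds S) : S.Nodup := by
  induction h with
  | nil => exact List.nodup_nil
  | snoc S s _ hs _ ih => exact List.concat_eq_append ▸ ih.concat hs

theorem GreedySeeds.greedyReachable (hδ : 0 < I.delta) {S : List I.Voter} (h : I.GreedySeeds S) :
    GreedyReachable I.expCover S.length S.toFinset := by
  induction h with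
  | nil => exact .zero
  | snoc S s _ _ hmax ih =>
    have hmono := I.isMonotoneSubmodular_expCover.mono (Finset.subset_insert s S.toFinset)
    rw [List.length_append, List.length_singleton, toFinset_append_singleton]
    refine ih.succ hmono fun t => ?_
    by_cases ht : t ∈ S
    · rwa [Finset.insert_eq_of_mem (List.mem_toFinset.2 ht)]
    · simpa only [expVotes_deltaPlan hδ, toFinset_append_singleton, add_le_add_iff_left]
        using hmax t ht

theorem GreedySeeds.isApprox (hδ : 0 < I.delta) (hB : I.delta ≤ I.B) {S : List I.Voter}
    (h : I.GreedySeeds S) (hlen : S.length = I.seedCount) :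
    I.IsApprox I.ratio (I.deltaPlan S) := by
  refine isApprox_deltaPlan hδ hB h.nodup hlen.le fun T hT => ?_
  have hmargin : (0 : ℝ) ≤ 1 / (9 * (I.n : ℝ) ^ 2) := by positivity
  have hratio : 2 * I.ratio ≤ 1 - (1 - 1 / (I.maxSeeds : ℝ)) ^ S.length := by
    linarith [two_mul_ratio_add_le hδ hB hlen.ge]
  calc 2 * I.ratio * I.expCover T
      ≤ (1 - (1 - 1 / (I.maxSeeds : ℝ)) ^ S.length) * I.expCover T :=
        mul_le_mul_of_nonneg_right hratio (I.isMonotoneSubmodular_expCover.nonneg T)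
    _ ≤ I.expCover S.toFinset := I.isMonotoneSubmodular_expCover.le_of_greedyReachable
        (h.greedyReachable hδ) (maxSeeds_pos hδ hB) hT

end ECSInstance

/-! ### Functions computable in polynomial time -/

/-- Types whose elements are encoded as values, on which programs operate. -/
class ToVal (α : Type*) where
  toVal : α → Val

open ToVal (toVal)

instance : ToVal ℕ := ⟨Val.num⟩

instance : ToVal Bool := ⟨fun b => Val.num b.toNat⟩

instance {α β : Type*} [ToVal α] [ToVal β] : ToVal (α × β) :=
  ⟨fun x => Val.pair (toVal x.1) (toVal x.2)⟩

instance {α : Type*} [ToVal α] : ToVal (List α) := ⟨fun l => Val.ofList (l.map toVal)⟩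

/-- The length of the encoding, with respect to which running times are measured. -/
def valSize {α : Type*} [ToVal α] (a : α) : ℕ := (toVal a).size

section ValSize

variable {α β : Type*} [ToVal α] [ToVal β]

theorem valSize_nat (k : ℕ) : valSize k = 1 + k.size := rfl

theorem valSize_pair (x : α × β) : valSize x = 1 + valSize x.1 + valSize x.2 := rfl

theorem valSize_nil : valSize ([] : List α) = 1 := rfl

theorem valSize_cons (a : α) (l : List α) : valSize (a :: l) = 1 + valSize a + valSize l := rfl

theorem valSize_bool_le (b : Bool) : valSize b ≤ 2 := by cases b <;> decide

theorem valSize_append (l l' : List α) : valSize (l ++ l') + 1 = valSize l + valSize l' := by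
  induction l with
  | nil => rw [List.nil_append, valSize_nil, add_comm]
  | cons a l ih => rw [List.cons_append, valSize_cons, valSize_cons]; omega

theorem valSize_le_of_mem {a : α} {l : List α} (h : a ∈ l) : valSize a ≤ valSize l := by
  obtain ⟨l₁, l₂, rfl⟩ := List.append_of_mem h
  have := valSize_append l₁ (a :: l₂)
  rw [valSize_cons] at this
  omega

theorem valSize_le_of_sublist {l l' : List α} (h : l.Sublist l') : valSize l ≤ valSize l' := by
  induction h with
  | slnil => exact le_rfl
  | cons a _ ih => rw [valSize_cons]; omega
  | cons_cons a _ ih => rw [valSize_cons, valSize_cons]; omega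

theorem length_lt_valSize (l : List α) : l.length < valSize l := by
  induction l with
  | nil => exact Nat.one_pos
  | cons a l ih => rw [valSize_cons, List.length_cons]; omega

theorem valSize_le_of_forall_mem {l : List α} {w : ℕ} (h : ∀ a ∈ l, valSize a ≤ w) :
    valSize l ≤ 1 + l.length * (1 + w) := by
  induction l with
  | nil => simp [valSize_nil]
  | cons a l ih =>
    rw [List.forall_mem_cons] at h
    have htail := ih h.2
    rw [valSize_cons, List.length_cons, Nat.succ_mul]
    omega

theorem valSize_nat_mono {a b : ℕ} (h : a ≤ b) : valSize a ≤ valSize b :=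
  Nat.add_le_add_left (Nat.size_le_size h) 1

theorem valSize_nat_le (a : ℕ) : valSize a ≤ 1 + a :=
  Nat.add_le_add_left (Nat.size_le.2 Nat.lt_two_pow_self) 1

theorem valSize_add_le (a b : ℕ) : valSize (a + b) ≤ valSize a + valSize b := by
  suffices h : (a + b).size ≤ a.size + b.size + 1 by simp only [valSize_nat]; omega
  rw [Nat.size_le, pow_succ]
  have ha : a < 2 ^ (a.size + b.size) :=
    (Nat.lt_size_self a).trans_le (Nat.pow_le_pow_right two_pos (Nat.le_add_right _ _))
  have hb : b < 2 ^ (a.size + b.size) :=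
    (Nat.lt_size_self b).trans_le (Nat.pow_le_pow_right two_pos (Nat.le_add_left _ _))
  omega

theorem valSize_mul_le (a b : ℕ) : valSize (a * b) ≤ valSize a + valSize b := by
  suffices h : (a * b).size ≤ a.size + b.size by simp only [valSize_nat]; omega
  rw [Nat.size_le, pow_add]
  exact Nat.mul_lt_mul'' (Nat.lt_size_self a) (Nat.lt_size_self b)

end ValSize

/-- A quantity that is at most a polynomial in the size of the input on which it depends. -/
def PolyBounded {α : Type*} [ToVal α] (g : α → ℕ) : Prop :=
  ∃ p : Polynomial ℕ, ∀ a, g a ≤ p.eval (valSize a)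

theorem eval_mono_of_nat (p : Polynomial ℕ) : Monotone fun n => p.eval n := by
  intro a b h
  simp only [Polynomial.eval_eq_sum_range]
  gcongr

namespace PolyBounded

variable {α β : Type*} [ToVal α] [ToVal β] {f g : α → ℕ}

theorem mono (hg : PolyBounded g) (h : ∀ a, f a ≤ g a) : PolyBounded f :=
  hg.imp fun _ hp a => (h a).trans (hp a)

theorem const (k : ℕ) : PolyBounded fun _ : α => k := ⟨.C k, by simp⟩

theorem size : PolyBounded fun a : α => valSize a := ⟨.X, by simp⟩

theorem add (hf : PolyBounded f) (hg : PolyBounded g) : PolyBounded fun a => f a + g a :=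
  let ⟨p, hp⟩ := hf
  let ⟨q, hq⟩ := hg
  ⟨p + q, fun a => by simpa using Nat.add_le_add (hp a) (hq a)⟩

theorem mul (hf : PolyBounded f) (hg : PolyBounded g) : PolyBounded fun a => f a * g a :=
  let ⟨p, hp⟩ := hf
  let ⟨q, hq⟩ := hg
  ⟨p * q, fun a => by simpa using Nat.mul_le_mul (hp a) (hq a)⟩

theorem eval (hg : PolyBounded g) (q : Polynomial ℕ) : PolyBounded fun a => q.eval (g a) :=
  let ⟨p, hp⟩ := hg
  ⟨q.comp p, fun a => by simpa using eval_mono_of_nat q (hp a)⟩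

theorem comp {h : β → ℕ} (hh : PolyBounded h) {F : α → β}
    (hF : PolyBounded fun a => valSize (F a)) : PolyBounded fun a => h (F a) :=
  let ⟨q, hq⟩ := hh
  (hF.eval q).mono fun a => hq (F a)

end PolyBounded

/-- The programs `P b` map the input `a` in the variable `b` to the result `c` in the variable `b`
within `t` steps, and do not change the variables below `b`, which may be in use elsewhere. -/
structure Computes {α β : Type*} [ToVal α] [ToVal β] (P : ℕ → Prog) (a : α) (c : β) (t : ℕ) :
    Prop where
  result : ∀ {b : ℕ} {σ : Store}, σ b = toVal a → ((P b).run σ).1 b = toVal c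
  frame : ∀ {b : ℕ} {σ : Store}, σ b = toVal a → ∀ x < b, ((P b).run σ).1 x = σ x
  time_le : ∀ {b : ℕ} {σ : Store}, σ b = toVal a → ((P b).run σ).2 ≤ t

namespace Computes

variable {α β γ : Type*} [ToVal α] [ToVal β] [ToVal γ] {P Q R : ℕ → Prog} {a : α} {c : β}
  {t u : ℕ}

theorem of_le (h : Computes P a c t) (htu : t ≤ u) : Computes P a c u :=
  ⟨h.result, h.frame, fun hσ => (h.time_le hσ).trans htu⟩

theorem assign {e : ℕ → PExpr}
    (h : ∀ b σ, σ b = toVal a → (e b).eval σ = toVal c ∧ (e b).cost σ ≤ t) :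
    Computes (fun b => .assign b (e b)) a c (1 + t) where
  result hσ := by simpa [Prog.run] using (h _ _ hσ).1
  frame _ x hx := by simp [Prog.run, hx.ne]
  time_le hσ := Nat.add_le_add_left (h _ _ hσ).2 1

theorem seq {d : γ} (hP : Computes P a c t) (hQ : Computes Q c d u) :
    Computes (fun b => .seq (P b) (Q b)) a d (t + u) where
  result hσ := hQ.result (hP.result hσ)
  frame hσ x hx := (hQ.frame (hP.result hσ) x hx).trans (hP.frame hσ x hx)
  time_le hσ := Nat.add_le_add (hP.time_le hσ) (hQ.time_le (hP.result hσ))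

end Computes

namespace Prog

/-- Runs `P` on a copy in the variable `d` of the variable `b`. -/
def onCopy (P : ℕ → Prog) (b d : ℕ) : Prog := .seq (.assign d (.var b)) (P d)

/-- The body of the loop that computes a fold: the input of the fold is in the variable `b`, its
state in `b + 1`, and the entry of the list in `b + 2`. -/
def foldBody (S : ℕ → Prog) (b : ℕ) : Prog :=
  .seq (.assign (b + 3) (.pair (.var b) (.pair (.var (b + 1)) (.var (b + 2)))))
    (.seq (S (b + 3)) (.assign (b + 1) (.var (b + 3))))

end Prog

namespace Computes

variable {α β γ : Type*} [ToVal α] [ToVal β] [ToVal γ] {P Q R : ℕ → Prog} {a : α} {c : β}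
  {t u : ℕ}

theorem run_onCopy (hP : Computes P a c t) {b d : ℕ} {σ : Store} (hσ : σ b = toVal a) :
    ((Prog.onCopy P b d).run σ).1 d = toVal c ∧
      (∀ x < d, ((Prog.onCopy P b d).run σ).1 x = σ x) ∧
      ((Prog.onCopy P b d).run σ).2 ≤ t + 2 := by
  have hcopy : Function.update σ d (σ b) d = toVal a := by rw [Function.update_self, hσ]
  refine ⟨hP.result hcopy, fun x hx => ?_, ?_⟩
  · exact (hP.frame hcopy x hx).trans (Function.update_of_ne hx.ne _ _)
  · have := hP.time_le hcopy
    simp only [Prog.onCopy, Prog.run, PExpr.eval, PExpr.cost]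
    omega

theorem pair {d : γ} (hP : Computes P a c t) (hQ : Computes Q a d u) :
    Computes (fun b => .seq (Prog.onCopy P b (b + 1)) (.seq (Prog.onCopy Q b (b + 2))
      (.assign b (.pair (.var (b + 1)) (.var (b + 2)))))) a (c, d) (t + u + 8) := by
  suffices h : ∀ (b : ℕ) (σ : Store), σ b = toVal a →
      let r := Prog.run (.seq (Prog.onCopy P b (b + 1)) (.seq (Prog.onCopy Q b (b + 2))
        (.assign b (.pair (.var (b + 1)) (.var (b + 2)))))) σ
      r.1 b = toVal (c, d) ∧ (∀ x < b, r.1 x = σ x) ∧ r.2 ≤ t + u + 8 from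
    ⟨fun hσ => (h _ _ hσ).1, fun hσ => (h _ _ hσ).2.1, fun hσ => (h _ _ hσ).2.2⟩
  intro b σ hσ
  obtain ⟨hc, hframe, htime⟩ := hP.run_onCopy (d := b + 1) hσ
  set σ₁ := ((Prog.onCopy P b (b + 1)).run σ).1 with hσ₁
  obtain ⟨hd, hframe', htime'⟩ :=
    hQ.run_onCopy (d := b + 2) ((hframe b b.lt_succ_self).trans hσ)
  refine ⟨?_, fun x hx => ?_, ?_⟩
  · simp only [Prog.run, PExpr.eval, ← hσ₁, Function.update_self, hd,
      hframe' (b + 1) (b + 1).lt_succ_self, hc]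
    rfl
  · simp only [Prog.run, ← hσ₁]
    rw [Function.update_of_ne hx.ne, hframe' x (by omega), hframe x (by omega)]
  · simp only [Prog.run, PExpr.cost, ← hσ₁]
    omega

theorem ite {p : Bool} {c' : β} {w : ℕ} (hR : Computes R a p w) (hP : Computes P a c t)
    (hQ : Computes Q a c' u) :
    Computes (fun b => .seq (Prog.onCopy R b (b + 1)) (.ite (.var (b + 1)) (P b) (Q b))) a
      (if p then c else c') (w + max t u + 4) := by
  suffices h : ∀ (b : ℕ) (σ : Store), σ b = toVal a →
      let r := Prog.run (.seq (Prog.onCopy R b (b + 1)) (.ite (.var (b + 1)) (P b) (Q b))) σ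
      r.1 b = toVal (if p then c else c') ∧ (∀ x < b, r.1 x = σ x) ∧
        r.2 ≤ w + max t u + 4 from
    ⟨fun hσ => (h _ _ hσ).1, fun hσ => (h _ _ hσ).2.1, fun hσ => (h _ _ hσ).2.2⟩
  intro b σ hσ
  obtain ⟨hp, hframe, htime⟩ := hR.run_onCopy (d := b + 1) hσ
  set σ₁ := ((Prog.onCopy R b (b + 1)).run σ).1 with hσ₁
  have ha : σ₁ b = toVal a := (hframe b b.lt_succ_self).trans hσ
  have hlow : ∀ x < b, σ₁ x = σ x := fun x hx => hframe x (by omega)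
  have hcond : (σ₁ (b + 1)).toNum ≠ 0 ↔ p = true := by
    rw [hp]; cases p <;> simp [toVal, Val.toNum]
  simp only [Prog.run, PExpr.eval, PExpr.cost, ← hσ₁, hcond]
  split_ifs
  · have := hP.time_le ha
    exact ⟨hP.result ha, fun x hx => (hP.frame ha x hx).trans (hlow x hx), by omega⟩
  · have := hQ.time_le ha
    exact ⟨hQ.result ha, fun x hx => (hQ.frame ha x hx).trans (hlow x hx), by omega⟩

theorem run_foldBody {d : γ} {c' : β} (hP : Computes P (a, c, d) c' t) {b : ℕ} {σ : Store}
    (ha : σ b = toVal a) (hc : σ (b + 1) = toVal c) (hd : σ (b + 2) = toVal d) :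
    ((Prog.foldBody P b).run σ).1 (b + 1) = toVal c' ∧
      (∀ x ≤ b, ((Prog.foldBody P b).run σ).1 x = σ x) ∧
      ((Prog.foldBody P b).run σ).2 ≤ t + 8 := by
  set v := Val.pair (σ b) (Val.pair (σ (b + 1)) (σ (b + 2))) with hv
  have hin : Function.update σ (b + 3) v (b + 3) = toVal (a, c, d) := by
    rw [Function.update_self, hv, ha, hc, hd]
    rfl
  refine ⟨?_, fun x hx => ?_, ?_⟩
  · simpa [Prog.foldBody, Prog.run, PExpr.eval] using hP.result hin
  · simp only [Prog.foldBody, Prog.run, PExpr.eval, ← hv]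
    rw [Function.update_of_ne (by omega), hP.frame hin x (by omega),
      Function.update_of_ne (by omega)]
  · have := hP.time_le hin
    simp only [Prog.foldBody, Prog.run, PExpr.eval, PExpr.cost, ← hv]
    omega

theorem loop_foldBody {s : α → β → γ → β} {T : ℕ} {b : ℕ} {l : List γ} {σ : Store}
    (hP : ∀ l₁ d, l₁ ++ [d] <+: l →
      Computes P (a, l₁.foldl (s a) c, d) (s a (l₁.foldl (s a) c) d) T)
    (ha : σ b = toVal a) (hc : σ (b + 1) = toVal c) :
    let r := Prog.loop (Prog.foldBody P b).run (b + 2) (toVal l) σ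
    r.1 (b + 1) = toVal (l.foldl (s a) c) ∧ (∀ x ≤ b, r.1 x = σ x) ∧
      r.2 ≤ 1 + l.length * (T + 9) := by
  induction l generalizing c σ with
  | nil => exact ⟨hc, fun _ _ => rfl, by simp [toVal, Prog.loop, Val.ofList]⟩
  | cons d l ih =>
    set σ₀ := Function.update σ (b + 2) (toVal d)
    have hσ₀' : ∀ x < b + 2, σ₀ x = σ x := fun x hx => Function.update_of_ne hx.ne _ _
    obtain ⟨hc', hframe, htime⟩ := (hP [] d (by simp)).run_foldBody
      ((hσ₀' b (by omega)).trans ha) ((hσ₀' (b + 1) (by omega)).trans hc)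
      (Function.update_self _ _ _)
    set σ₁ := ((Prog.foldBody P b).run σ₀).1
    have hlow : ∀ x ≤ b, σ₁ x = σ x := fun x hx => (hframe x hx).trans (hσ₀' x (by omega))
    have hloop : Prog.loop (Prog.foldBody P b).run (b + 2) (toVal (d :: l)) σ =
        ((Prog.loop (Prog.foldBody P b).run (b + 2) (toVal l) σ₁).1,
          1 + ((Prog.foldBody P b).run σ₀).2 +
            (Prog.loop (Prog.foldBody P b).run (b + 2) (toVal l) σ₁).2) := rfl
    obtain ⟨hresult, hframe', htime'⟩ := ih
      (fun l₁ e hl => hP (d :: l₁) e ((List.prefix_cons_inj d).2 hl))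
      ((hlow b le_rfl).trans ha) hc'
    rw [hloop, List.length_cons, Nat.succ_mul]
    exact ⟨hresult, fun x hx => (hframe' x hx).trans (hlow x hx), by dsimp only; omega⟩

theorem foldl {s : α → β → γ → β} {T : ℕ} {l : List γ} (hQ : Computes Q a c t)
    (hR : Computes R a l u)
    (hP : ∀ l₁ d, l₁ ++ [d] <+: l →
      Computes P (a, l₁.foldl (s a) c, d) (s a (l₁.foldl (s a) c) d) T) :
    Computes (fun b => .seq (Prog.onCopy Q b (b + 1)) (.seq (Prog.onCopy R b (b + 2))
      (.seq (.forEach (b + 2) (.var (b + 2)) (Prog.foldBody P b)) (.assign b (.var (b + 1))))))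
      a (l.foldl (s a) c) (t + u + l.length * (T + 9) + 9) := by
  suffices h : ∀ (b : ℕ) (σ : Store), σ b = toVal a →
      let r := Prog.run (.seq (Prog.onCopy Q b (b + 1)) (.seq (Prog.onCopy R b (b + 2))
        (.seq (.forEach (b + 2) (.var (b + 2)) (Prog.foldBody P b))
          (.assign b (.var (b + 1)))))) σ
      r.1 b = toVal (l.foldl (s a) c) ∧ (∀ x < b, r.1 x = σ x) ∧
        r.2 ≤ t + u + l.length * (T + 9) + 9 from
    ⟨fun hσ => (h _ _ hσ).1, fun hσ => (h _ _ hσ).2.1, fun hσ => (h _ _ hσ).2.2⟩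
  intro b σ hσ
  obtain ⟨hc, hframe, htime⟩ := hQ.run_onCopy (d := b + 1) hσ
  set σ₁ := ((Prog.onCopy Q b (b + 1)).run σ).1 with hσ₁
  obtain ⟨hl, hframe', htime'⟩ :=
    hR.run_onCopy (d := b + 2) ((hframe b b.lt_succ_self).trans hσ)
  set σ₂ := ((Prog.onCopy R b (b + 2)).run σ₁).1 with hσ₂
  have hlow : ∀ x ≤ b, σ₂ x = σ x := fun x hx =>
    (hframe' x (by omega)).trans (hframe x (by omega))
  obtain ⟨hresult, hframe₃, htime₃⟩ := loop_foldBody hP ((hlow b le_rfl).trans hσ)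
    ((hframe' (b + 1) (b + 1).lt_succ_self).trans hc)
  refine ⟨?_, fun x hx => ?_, ?_⟩
  · simpa only [Prog.run, PExpr.eval, ← hσ₁, ← hσ₂, hl, Function.update_self] using hresult
  · simp only [Prog.run, PExpr.eval, ← hσ₁, ← hσ₂, hl]
    rw [Function.update_of_ne hx.ne, hframe₃ x hx.le, hlow x hx.le]
  · simp only [Prog.run, PExpr.eval, PExpr.cost, ← hσ₁, ← hσ₂, hl]
    omega

end Computes

namespace PExpr

/-- The constant expression with value `v`. -/
def ofVal : Val → PExpr
  | .num k => .const k
  | .pair v w => .pair (ofVal v) (ofVal w)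

theorem eval_ofVal (v : Val) (σ : Store) : (ofVal v).eval σ = v := by
  induction v with
  | num k => rfl
  | pair v w hv hw => rw [ofVal, eval, hv, hw]

theorem cost_ofVal (v : Val) (σ : Store) : (ofVal v).cost σ = v.size := by
  induction v with
  | num k => rfl
  | pair v w hv hw => rw [ofVal, cost, hv, hw, Val.size]

end PExpr

/-- The functions that a program computes in time polynomial in the size of the input. The bound on
the size of the result makes them closed under composition, as pairing costs one step however large
the values are. -/
def PolyTime {α β : Type*} [ToVal α] [ToVal β] (f : α → β) : Prop :=
  PolyBounded (fun a => valSize (f a)) ∧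
    ∃ (P : ℕ → Prog) (t : α → ℕ), PolyBounded t ∧ ∀ a, Computes P a (f a) (t a)

namespace PolyTime

variable {α β γ : Type*} [ToVal α] [ToVal β] [ToVal γ]

theorem of_expr {f : α → β} {t : α → ℕ} (e : ℕ → PExpr) (hf : PolyBounded fun a => valSize (f a))
    (ht : PolyBounded t)
    (h : ∀ a b σ, σ b = toVal a → (e b).eval σ = toVal (f a) ∧ (e b).cost σ ≤ t a) : PolyTime f :=
  ⟨hf, _, _, (PolyBounded.const 1).add ht, fun a => Computes.assign (h a)⟩

theorem id : PolyTime fun a : α => a :=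
  of_expr .var .size (.const 1) fun _ _ _ h => ⟨h, le_rfl⟩

theorem fst : PolyTime fun x : α × β => x.1 :=
  of_expr (fun b => .fst (.var b)) (.mono .size fun x => by rw [valSize_pair]; omega) (.const 2)
    fun _ _ _ h => ⟨by rw [PExpr.eval, PExpr.eval, h]; rfl, le_rfl⟩

theorem snd : PolyTime fun x : α × β => x.2 :=
  of_expr (fun b => .snd (.var b)) (.mono .size fun x => by rw [valSize_pair]; omega) (.const 2)
    fun _ _ _ h => ⟨by rw [PExpr.eval, PExpr.eval, h]; rfl, le_rfl⟩

theorem const (c : β) : PolyTime fun _ : α => c :=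
  of_expr (fun _ => .ofVal (toVal c)) (.const _) (.const (valSize c))
    fun _ _ σ _ => ⟨PExpr.eval_ofVal _ σ, (PExpr.cost_ofVal _ σ).le⟩

theorem comp {g : β → γ} {f : α → β} (hg : PolyTime g) (hf : PolyTime f) :
    PolyTime fun a => g (f a) :=
  let ⟨_, _, ht, hP⟩ := hf.2
  let ⟨_, _, hu, hQ⟩ := hg.2
  ⟨hg.1.comp hf.1, _, _, ht.add (hu.comp hf.1), fun a => (hP a).seq (hQ (f a))⟩

theorem pair {f : α → β} {g : α → γ} (hf : PolyTime f) (hg : PolyTime g) :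
    PolyTime fun a => (f a, g a) :=
  let ⟨_, _, ht, hP⟩ := hf.2
  let ⟨_, _, hu, hQ⟩ := hg.2
  ⟨((PolyBounded.const 1).add hf.1).add hg.1, _, _, (ht.add hu).add (.const 8),
    fun a => (hP a).pair (hQ a)⟩

theorem ite {c : α → Prop} [DecidablePred c] {f g : α → β} (hc : PolyTime fun a => decide (c a))
    (hf : PolyTime f) (hg : PolyTime g) : PolyTime fun a => if c a then f a else g a := by
  obtain ⟨_, R, w, hw, hR⟩ := hc
  obtain ⟨hfsize, P, t, ht, hP⟩ := hf
  obtain ⟨hgsize, Q, u, hu, hQ⟩ := hg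
  have hcomp := fun a => ((hR a).ite (hP a) (hQ a)).of_le (u := w a + (t a + u a) + 4) (by omega)
  simp only [decide_eq_true_eq] at hcomp
  refine ⟨(hfsize.add hgsize).mono fun a => ?_, _, _, (hw.add (ht.add hu)).add (.const 4), hcomp⟩
  dsimp only
  split_ifs <;> omega

theorem cons {f : α → β} {l : α → List β} (hf : PolyTime f) (hl : PolyTime l) :
    PolyTime fun a => f a :: l a :=
  comp (g := fun x : β × List β => x.1 :: x.2)
    (of_expr .var (.mono .size fun _ => le_rfl) (.const 1) fun _ _ _ h => ⟨h, le_rfl⟩) (hf.pair hl)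

section Arith

variable {g h : α → ℕ}

theorem arith {f : ℕ → ℕ → β} (o : ArithOp)
    (hf : ∀ m n, toVal (f m n) = Val.num (o.apply m n))
    (hsize : ∀ m n, valSize (f m n) ≤ valSize m + valSize n + 1) (hg : PolyTime g)
    (hh : PolyTime h) : PolyTime fun a => f (g a) (h a) := by
  refine comp (g := fun x : ℕ × ℕ => f x.1 x.2) (of_expr (t := fun x => 4 + valSize x)
    (fun b => .arith o (.fst (.var b)) (.snd (.var b)))
    (.mono .size fun x => (hsize _ _).trans (by rw [valSize_pair]; omega))
    ((PolyBounded.const 4).add .size) fun x b σ hσ => ?_) (hg.pair hh)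
  have hfst : (σ b).fst.toNum = x.1 := by rw [hσ]; rfl
  have hsnd : (σ b).snd.toNum = x.2 := by rw [hσ]; rfl
  simp only [PExpr.eval, PExpr.cost, hf, hfst, hsnd, valSize_pair, valSize_nat, true_and]
  omega

theorem add (hg : PolyTime g) (hh : PolyTime h) : PolyTime fun a => g a + h a :=
  hg.arith .add (fun _ _ => rfl) (fun m n => (valSize_add_le m n).trans (Nat.le_succ _)) hh

theorem mul (hg : PolyTime g) (hh : PolyTime h) : PolyTime fun a => g a * h a :=
  hg.arith .mul (fun _ _ => rfl) (fun m n => (valSize_mul_le m n).trans (Nat.le_succ _)) hh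

theorem sub (hg : PolyTime g) (hh : PolyTime h) : PolyTime fun a => g a - h a :=
  hg.arith .sub (fun _ _ => rfl)
    (fun m n => (valSize_nat_mono (Nat.sub_le m n)).trans (by omega)) hh

theorem lt (hg : PolyTime g) (hh : PolyTime h) : PolyTime fun a => decide (g a < h a) :=
  hg.arith .lt (f := fun m n => decide (m < n))
    (fun m n => by by_cases hmn : m < n <;> simp [toVal, ArithOp.apply, hmn])
    (fun m n => (valSize_bool_le _).trans (by simp only [valSize_nat]; omega)) hh

theorem eq (hg : PolyTime g) (hh : PolyTime h) : PolyTime fun a => decide (g a = h a) :=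
  hg.arith .eq (f := fun m n => decide (m = n))
    (fun m n => by by_cases hmn : m = n <;> simp [toVal, ArithOp.apply, hmn])
    (fun m n => (valSize_bool_le _).trans (by simp only [valSize_nat]; omega)) hh

theorem max (hg : PolyTime g) (hh : PolyTime h) : PolyTime fun a => max (g a) (h a) := by
  simpa only [Nat.sub_add_eq_max] using (hg.sub hh).add hh

end Arith

theorem and {p q : α → Bool} (hp : PolyTime p) (hq : PolyTime q) :
    PolyTime fun a => p a && q a := by
  have h : ∀ a, (if p a = true then q a else false) = (p a && q a) := fun a => by
    cases p a <;> rfl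
  simpa only [h] using ite (c := fun a => p a = true) (by simpa only [Bool.decide_eq_true]) hq
    (const false)

theorem or {p q : α → Bool} (hp : PolyTime p) (hq : PolyTime q) :
    PolyTime fun a => p a || q a := by
  have h : ∀ a, (if p a = true then true else q a) = (p a || q a) := fun a => by
    cases p a <;> rfl
  simpa only [h] using ite (c := fun a => p a = true) (by simpa only [Bool.decide_eq_true])
    (const true) hq

theorem foldl_of_prefix {l : α → List γ} {i : α → β} {s : α → β → γ → β} {w : α → ℕ}
    (hl : PolyTime l) (hi : PolyTime i) (hs : PolyTime fun x : α × β × γ => s x.1 x.2.1 x.2.2)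
    (hw : PolyBounded w) (hsw : ∀ a l₁, l₁ <+: l a → valSize (l₁.foldl (s a) (i a)) ≤ w a) :
    PolyTime fun a => (l a).foldl (s a) (i a) := by
  obtain ⟨hlsize, R, u, hu, hR⟩ := hl
  obtain ⟨_, Q, t, ht, hQ⟩ := hi
  obtain ⟨_, P, v, ⟨p, hp⟩, hP⟩ := hs
  set T : α → ℕ := fun a => p.eval (2 + valSize a + w a + valSize (l a))
  have hT : PolyBounded T :=
    ((((PolyBounded.const 2).add .size).add hw).add hlsize).eval p
  have hPT : ∀ a l₁ d, l₁ ++ [d] <+: l a → Computes P (a, l₁.foldl (s a) (i a), d)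
      (s a (l₁.foldl (s a) (i a)) d) (T a) := fun a l₁ d hpre => by
    refine (hP (a, _, d)).of_le ((hp _).trans (eval_mono_of_nat p ?_))
    have hstate := hsw a l₁ ((List.prefix_append l₁ [d]).trans hpre)
    have hentry : valSize d ≤ valSize (l a) := valSize_le_of_mem (hpre.subset (by simp))
    simp only [valSize_pair]
    omega
  refine ⟨hw.mono fun a => hsw a _ (List.prefix_refl _), _,
    fun a => t a + u a + valSize (l a) * (T a + 9) + 9,
    ((ht.add hu).add (hlsize.mul (hT.add (.const 9)))).add (.const 9),
    fun a => ((hQ a).foldl (hR a) (hPT a)).of_le ?_⟩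
  dsimp only
  gcongr
  exact (length_lt_valSize _).le

theorem foldl {l : α → List γ} {i : α → β} {s : α → β → γ → β} {w : α → ℕ}
    (hl : PolyTime l) (hi : PolyTime i) (hs : PolyTime fun x : α × β × γ => s x.1 x.2.1 x.2.2)
    (hw : PolyBounded w) (hsw : ∀ a c, ∀ d ∈ l a, valSize (s a c d) ≤ valSize c + w a) :
    PolyTime fun a => (l a).foldl (s a) (i a) := by
  have hgrowth : ∀ a c (l₁ : List γ), l₁ ⊆ l a →
      valSize (l₁.foldl (s a) c) ≤ valSize c + l₁.length * w a := by
    intro a c l₁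
    induction l₁ generalizing c with
    | nil => simp
    | cons d l₁ ih =>
      intro hd
      rw [List.cons_subset] at hd
      have htail := ih (s a c d) hd.2
      have hhead := hsw a c d hd.1
      rw [List.foldl_cons, List.length_cons, Nat.succ_mul]
      omega
  refine foldl_of_prefix hl hi hs (hi.1.add (hl.1.mul hw)) fun a l₁ hpre =>
    (hgrowth a (i a) l₁ hpre.subset).trans ?_
  gcongr
  exact hpre.length_le.trans (length_lt_valSize _).le

theorem valSize_le_of_mem {l : α → List β} {f : α → β → γ} (hl : PolyTime l)
    (hf : PolyTime fun x : α × β => f x.1 x.2) :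
    ∃ w : α → ℕ, PolyBounded w ∧ ∀ a, ∀ d ∈ l a, valSize (f a d) ≤ w a := by
  obtain ⟨p, hp⟩ := hf.1
  refine ⟨_, (((PolyBounded.const 1).add .size).add hl.1).eval p, fun a d hd =>
    (hp (a, d)).trans (eval_mono_of_nat p ?_)⟩
  rw [valSize_pair]
  exact Nat.add_le_add_left (_root_.valSize_le_of_mem hd) _

section List

variable {l : α → List β}

theorem foldl_cons {l' : α → List β} (hl : PolyTime l) (hl' : PolyTime l') :
    PolyTime fun a => (l a).foldl (fun c d => d :: c) (l' a) :=
  foldl hl hl' ((snd.comp snd).cons (fst.comp snd)) ((PolyBounded.const 1).add hl.1)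
    fun a c d hd => by
      have := _root_.valSize_le_of_mem hd
      rw [valSize_cons]
      omega

theorem append {l' : α → List β} (hl : PolyTime l) (hl' : PolyTime l') :
    PolyTime fun a => l a ++ l' a := by
  simpa using foldl_cons (foldl_cons hl (const [])) hl'

theorem append_singleton {f : α → β} (hl : PolyTime l) (hf : PolyTime f) :
    PolyTime fun a => l a ++ [f a] :=
  hl.append (hf.cons (const []))

theorem flatMap {f : α → β → List γ} (hl : PolyTime l) (hf : PolyTime fun x : α × β => f x.1 x.2) :
    PolyTime fun a => (l a).flatMap (f a) := by
  obtain ⟨w, hw, hfw⟩ := hl.valSize_le_of_mem hf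
  suffices PolyTime fun a => (l a).foldl (fun c d => c ++ f a d) [] by
    simpa only [List.foldl_append_eq_append, List.nil_append, ← List.flatMap_def] using this
  refine foldl hl (const []) ((fst.comp snd).append (hf.comp (fst.pair (snd.comp snd)))) hw
    fun a c d hd => ?_
  have hsize := valSize_append c (f a d)
  have := hfw a d hd
  omega

theorem map {f : α → β → γ} (hl : PolyTime l) (hf : PolyTime fun x : α × β => f x.1 x.2) :
    PolyTime fun a => (l a).map (f a) := by
  simpa only [List.map_eq_flatMap] using hl.flatMap (hf.cons (const []))

theorem filter {p : α → β → Bool} (hl : PolyTime l) (hp : PolyTime fun x : α × β => p x.1 x.2) :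
    PolyTime fun a => (l a).filter (p a) := by
  have h : ∀ a (l : List β), l.flatMap (fun d => if p a d = true then [d] else []) =
      l.filter (p a) := fun a l => by
    induction l with
    | nil => rfl
    | cons d l ih => rw [List.flatMap_cons, ih, List.filter_cons]; split_ifs <;> rfl
  simp only [← h]
  exact hl.flatMap (ite (by simpa only [Bool.decide_eq_true]) (snd.cons (const [])) (const []))

theorem sum {l : α → List ℕ} (hl : PolyTime l) : PolyTime fun a => (l a).sum := by
  simp only [List.sum_eq_foldl]
  exact foldl hl (const 0) ((fst.comp snd).add (snd.comp snd)) hl.1 fun a c d hd =>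
    (valSize_add_le c d).trans (Nat.add_le_add_left (_root_.valSize_le_of_mem hd) _)

theorem foldl_max {l : α → List ℕ} (hl : PolyTime l) :
    PolyTime fun a => (l a).foldl Max.max 0 := by
  refine foldl hl (const 0) ((fst.comp snd).max (snd.comp snd)) hl.1 fun a c d hd => ?_
  have := _root_.valSize_le_of_mem hd
  rcases max_choice c d with h | h <;> rw [h] <;> omega

theorem length (hl : PolyTime l) : PolyTime fun a => (l a).length := by
  simpa using (hl.map (f := fun _ _ => 1) (const 1)).sum

theorem any {p : α → β → Bool} (hl : PolyTime l) (hp : PolyTime fun x : α × β => p x.1 x.2) :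
    PolyTime fun a => (l a).any (p a) := by
  have h : ∀ a, decide (0 < ((l a).filter (p a)).length) = (l a).any (p a) := fun a => by
    rw [Bool.eq_iff_iff]
    simp [List.length_pos_iff_exists_mem]
  simpa only [h] using (const 0).lt (hl.filter hp).length

theorem contains {l : α → List ℕ} {f : α → ℕ} (hl : PolyTime l) (hf : PolyTime f) :
    PolyTime fun a => (l a).contains (f a) := by
  simp only [List.contains_eq_any_beq]
  exact hl.any ((hf.comp fst).eq snd)

theorem range_length (hl : PolyTime l) : PolyTime fun a => List.range (l a).length := by
  have h : ∀ l : List β, l.foldl (fun c _ => c ++ [c.length]) [] = List.range l.length := by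
    intro l
    induction l using List.reverseRecOn with
    | nil => rfl
    | append_singleton l d ih => simp [ih, List.range_succ]
  suffices PolyTime fun a => (l a).foldl (fun (c : List ℕ) _ => c ++ [c.length]) [] by
    simpa only [h] using this
  refine foldl_of_prefix hl (const []) ((fst.comp snd).append_singleton (fst.comp snd).length)
    ((PolyBounded.const 1).add (hl.1.mul
      ((PolyBounded.const 1).add ((PolyBounded.const 1).add hl.1)))) fun a l₁ hpre => ?_
  have hlength := hpre.length_le.trans (length_lt_valSize (l a)).le
  rw [h]
  refine (valSize_le_of_forall_mem (w := 1 + l₁.length) fun x hx =>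
    (valSize_nat_le x).trans (Nat.add_le_add_left (List.mem_range.1 hx).le _)).trans ?_
  rw [List.length_range]
  gcongr

theorem of_range {m : α → ℕ} (hm : PolyTime fun a => List.range (m a)) : PolyTime m := by
  simpa only [List.length_range] using hm.length

section Range

variable {m n : α → ℕ} (hm : PolyTime fun a => List.range (m a))

include hm

theorem range_add (hn : PolyTime fun a => List.range (n a)) :
    PolyTime fun a => List.range (m a + n a) := by
  simpa only [List.length_append, List.length_range] using (hm.append hn).range_length

theorem range_mul (hn : PolyTime fun a => List.range (n a)) :
    PolyTime fun a => List.range (m a * n a) := by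
  simpa using (hm.flatMap (f := fun a _ => List.range (n a)) (hn.comp fst)).range_length

theorem range_pow (k : ℕ) : PolyTime fun a => List.range (m a ^ k) := by
  induction k with
  | zero => simpa only [pow_zero] using const _
  | succ k ih => simpa only [pow_succ] using ih.range_mul hm

theorem two_pow : PolyTime fun a => 2 ^ m a := by
  have h : ∀ k, (List.range k).foldl (fun c _ => c * 2) 1 = 2 ^ k := fun k => by
    induction k with
    | zero => rfl
    | succ k ih => rw [List.range_succ, List.foldl_append, ih, pow_succ]; rfl
  simp only [← h]
  exact foldl hm (const 1) ((fst.comp snd).mul (const 2)) (.const (valSize 2))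
    fun a c d _ => valSize_mul_le c 2

end Range

theorem getD {i : α → ℕ} {d : α → β} (hl : PolyTime l) (hi : PolyTime i) (hd : PolyTime d) :
    PolyTime fun a => (l a).getD (i a) (d a) := by
  have h : ∀ (l : List β) i d, l.foldl (fun (c : ℕ × β) e =>
      (c.1 + 1, if c.1 = i then e else c.2)) (0, d) = (l.length, l.getD i d) := by
    intro l i d
    induction l using List.reverseRecOn with
    | nil => rfl
    | append_singleton l e ih =>
      rw [List.foldl_append, ih, List.foldl_cons, List.foldl_nil, List.length_append]
      grind
  suffices PolyTime fun a => ((l a).foldl (fun (c : ℕ × β) e =>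
      (c.1 + 1, if c.1 = i a then e else c.2)) (0, d a)).2 by simpa only [h] using this
  have hcount : PolyTime fun x : α × (ℕ × β) × β => x.2.1.1 := fst.comp (fst.comp snd)
  refine snd.comp (foldl hl ((const 0).pair hd) ((hcount.add (const 1)).pair
    (ite (hcount.eq (hi.comp fst)) (snd.comp snd) (snd.comp (fst.comp snd))))
    (hl.1.add (.const (valSize 1))) fun a c e he => ?_)
  have hentry := _root_.valSize_le_of_mem he
  have hsucc := valSize_add_le c.1 1
  simp only [valSize_pair]
  split_ifs <;> omega

end List

end PolyTime

/-! ### The algorithm -/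

namespace GreedySampling

/-- An edge `(u, v)` with the numerator and the denominator of its strength. The final `0` ends the
list as which `ECSInstance.encode` writes the edge. -/
abbrev Edge : Type := ℕ × ℕ × ℕ × ℕ × ℕ

/-- The input of the algorithm: the scores, the edges, the budget (with the `0` that ends the list)
and the confidence parameter in unary. The nesting follows `ECSInstance.encodeInput`, so that
`ToVal.toVal` yields the encoding of the statement. -/
abbrev RawInput : Type := (List (List ℕ) × List Edge × ℕ × ℕ) × List ℕ

/-- The `i`-th block of `m` random bits, read as a number. -/
def draw (bits : List ℕ) (m i : ℕ) : ℕ :=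
  (List.range m).foldl (fun c b => 2 * c + bits.getD (i * m + b) 0) 0

/-- The test whether the edge `e` is in the `i`-th sampled live graph on `n` voters, with `m` random
bits for every edge of every sample. -/
def isLive (bits : List ℕ) (m n i : ℕ) (e : Edge) : Bool :=
  decide (draw bits m ((i * n + e.1) * n + e.2.1) * e.2.2.2.1 < e.2.2.1 * 2 ^ m)

/-- The edge sets of `N` sampled live graphs. -/
def sampleGraphs (bits : List ℕ) (m n N : ℕ) (edges : List Edge) : List (List Edge) :=
  (List.range N).map fun i => edges.filter (isLive bits m n i)

/-- One round of the breadth-first search from `R`. -/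
def reachStep (vs : List ℕ) (H : List Edge) (R : List ℕ) : List ℕ :=
  vs.filter fun v => R.contains v || H.any fun e => R.contains e.1 && decide (e.2.1 = v)

/-- The voters of `vs` that are reachable from `S`, by as many rounds as there are voters. -/
def reach (vs : List ℕ) (H : List Edge) (S : List ℕ) : List ℕ :=
  vs.foldl (fun R _ => reachStep vs H R) S

/-- The objective of the greedy selection: the number of voters in `U` that are reached from `S`,
summed over the graphs `Gs`. -/
def value (vs U : List ℕ) (Gs : List (List Edge)) (S : List ℕ) : ℕ :=
  (Gs.map fun H => (U.filter fun v => (reach vs H S).contains v).length).sum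

/-- A voter whose addition to `S` maximizes the objective `f`. -/
def bestSeed (vs : List ℕ) (f : List ℕ → ℕ) (S : List ℕ) : ℕ :=
  vs.foldl (fun b s => if f (S ++ [b]) < f (S ++ [s]) then s else b) 0

/-- One greedy selection, for seeds of price `δ`: the best seed is added unless the budget `B` is
exhausted or the objective `f` does not increase. -/
def greedyStep (vs : List ℕ) (f : List ℕ → ℕ) (δ B : ℕ) (S : List ℕ) : List ℕ :=
  if B < (S.length + 1) * δ then S
  else if f S < f (S ++ [bestSeed vs f S]) then S ++ [bestSeed vs f S] else S

/-- The seeds that are selected greedily for the objective `f`. -/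
def greedySeeds (vs : List ℕ) (f : List ℕ → ℕ) (δ B : ℕ) : List ℕ :=
  vs.foldl (fun S _ => greedyStep vs f δ B S) []

/-- The parameter `δ` of an instance with the given score vectors, truncated at `0`. -/
def maxExcess (rows : List (List ℕ)) : ℕ :=
  (rows.flatMap fun r => r.map fun s => s - r.getD 0 0).foldl max 0

/-- The voters that do not rank `c_0` first. -/
def opposedVoters (rows : List (List ℕ)) : List ℕ :=
  (List.range rows.length).filter fun v =>
    (rows.getD v []).any fun s => decide ((rows.getD v []).getD 0 0 < s)

/-- The message with `δ` positive articles on `c_0` and nothing else, for `c` candidates, in the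
encoding of `ECSInstance.encodePlan`. -/
def message (δ c : ℕ) : List (ℕ × ℕ) :=
  (List.range c).map fun i => (if i = 0 then δ else 0, 0)

/-- The number of random bits per edge and sample. It makes the rounding of all the strengths to
multiples of `1 / 2 ^ bitCount n` change the expected number of covered voters by at most
`n ^ 3 / 2 ^ bitCount n ≤ 1 / (36 * n ^ 2)`. -/
def bitCount (n : ℕ) : ℕ := 11 * n

/-- The number of sampled live graphs. By Hoeffding's inequality, the empirical mean of the number
of covered voters is then within `1 / (36 * n ^ 2)` of its expectation for all the `2 ^ n` seed sets
at once, with probability at least `1 - 1 / 2 ^ k`. -/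
def sampleCount (n k : ℕ) : ℕ := 648 * n ^ 6 * (n + 1 + k)

/-- The number of opposed voters that `S` reaches, summed over the live graphs sampled with the
random bits `x.2` for the input `x.1`. -/
def sampleValue (x : RawInput × List ℕ) (S : List ℕ) : ℕ :=
  value (List.range x.1.1.1.length) (opposedVoters x.1.1.1)
    (sampleGraphs x.2 (bitCount x.1.1.1.length) x.1.1.1.length
      (sampleCount x.1.1.1.length x.1.2.length) x.1.1.2.1) S

/-- The seeds that the algorithm selects on the input `x.1` with the random bits `x.2`. -/
def selectedSeeds (x : RawInput × List ℕ) : List ℕ :=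
  greedySeeds (List.range x.1.1.1.length) (sampleValue x) (maxExcess x.1.1.1) x.1.1.2.2.1

/-- The algorithm, which sends the message of `δ` articles on `c_0` from every selected seed. -/
def algorithm (x : RawInput × List ℕ) : List (ℕ × List (ℕ × ℕ)) :=
  (selectedSeeds x).map fun s => (s, message (maxExcess x.1.1.1) (x.1.1.1.getD 0 []).length)

section PolyTime

variable {α : Type*} [ToVal α]

theorem polyTime_draw {bits : α → List ℕ} {m i : α → ℕ} (hbits : PolyTime bits)
    (hm : PolyTime fun a => List.range (m a)) (hi : PolyTime i) :
    PolyTime fun a => draw (bits a) (m a) (i a) := by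
  have hbit : PolyTime fun x : α × ℕ => (bits x.1).getD (i x.1 * m x.1 + x.2) 0 :=
    (hbits.comp .fst).getD (((hi.mul hm.of_range).comp .fst).add .snd) (.const 0)
  obtain ⟨w, hw, hbitw⟩ := hm.valSize_le_of_mem
    (f := fun a b => (bits a).getD (i a * m a + b) 0) hbit
  refine .foldl hm (.const 0) (((PolyTime.const 2).mul (.comp .fst .snd)).add
    (hbit.comp (.pair .fst (.comp .snd .snd)))) ((PolyBounded.const (valSize 2)).add hw)
    fun a c b hb => ?_
  have hdouble := valSize_mul_le 2 c
  have hsum := valSize_add_le (2 * c) ((bits a).getD (i a * m a + b) 0)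
  have := hbitw a b hb
  omega

theorem polyTime_isLive {bits : α → List ℕ} {m n i : α → ℕ} {e : α → Edge}
    (hbits : PolyTime bits) (hm : PolyTime fun a => List.range (m a)) (hn : PolyTime n)
    (hi : PolyTime i) (he : PolyTime e) :
    PolyTime fun a => isLive (bits a) (m a) (n a) (i a) (e a) :=
  have hu := PolyTime.fst.comp he
  have hv := PolyTime.fst.comp (PolyTime.snd.comp he)
  have hnum := PolyTime.fst.comp (PolyTime.snd.comp (PolyTime.snd.comp he))
  have hden := PolyTime.fst.comp (PolyTime.snd.comp (PolyTime.snd.comp (PolyTime.snd.comp he)))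
  have hindex := ((((hi.mul hn).add hu).mul hn).add hv)
  ((polyTime_draw hbits hm hindex).mul hden).lt (hnum.mul hm.two_pow)

theorem polyTime_sampleGraphs {bits : α → List ℕ} {m n N : α → ℕ} {edges : α → List Edge}
    (hbits : PolyTime bits) (hm : PolyTime fun a => List.range (m a)) (hn : PolyTime n)
    (hN : PolyTime fun a => List.range (N a)) (hedges : PolyTime edges) :
    PolyTime fun a => sampleGraphs (bits a) (m a) (n a) (N a) (edges a) :=
  have hlive := polyTime_isLive (hbits.comp (.comp .fst .fst)) (hm.comp (.comp .fst .fst))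
    (hn.comp (.comp .fst .fst)) (.comp .snd .fst) .snd
  hN.map (PolyTime.filter (p := fun x : α × ℕ => isLive (bits x.1) (m x.1) (n x.1) x.2)
    (hedges.comp .fst) hlive)

theorem polyTime_reachStep {vs R : α → List ℕ} {H : α → List Edge} (hvs : PolyTime vs)
    (hH : PolyTime H) (hR : PolyTime R) : PolyTime fun a => reachStep (vs a) (H a) (R a) := by
  have hedge : PolyTime fun x : (α × ℕ) × Edge =>
      (R x.1.1).contains x.2.1 && decide (x.2.2.1 = x.1.2) :=
    ((hR.comp (.comp .fst .fst)).contains (.comp .fst .snd)).and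
      (.eq (.comp .fst (.comp .snd .snd)) (.comp .snd .fst))
  exact hvs.filter (.or ((hR.comp .fst).contains .snd) (.any (hH.comp .fst) hedge))

theorem polyTime_reach {vs S : α → List ℕ} {H : α → List Edge} (hvs : PolyTime vs)
    (hH : PolyTime H) (hS : PolyTime S) : PolyTime fun a => reach (vs a) (H a) (S a) :=
  .foldl hvs hS (polyTime_reachStep (hvs.comp .fst) (hH.comp .fst) (.comp .fst .snd)) hvs.1
    fun _ _ _ _ => (valSize_le_of_sublist List.filter_sublist).trans (Nat.le_add_left _ _)

theorem polyTime_value {vs U S : α → List ℕ} {Gs : α → List (List Edge)} (hvs : PolyTime vs)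
    (hU : PolyTime U) (hGs : PolyTime Gs) (hS : PolyTime S) :
    PolyTime fun a => value (vs a) (U a) (Gs a) (S a) := by
  have hreached : PolyTime fun x : (α × List Edge) × ℕ =>
      (reach (vs x.1.1) x.1.2 (S x.1.1)).contains x.2 :=
    (polyTime_reach (hvs.comp (.comp .fst .fst)) (.comp .snd .fst)
      (hS.comp (.comp .fst .fst))).contains .snd
  exact (hGs.map (PolyTime.filter (hU.comp .fst) hreached).length).sum

theorem valSize_bestSeed_le (vs : List ℕ) (f : List ℕ → ℕ) (S : List ℕ) :
    valSize (bestSeed vs f S) ≤ valSize vs := by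
  refine List.foldlRecOn vs _ (motive := fun b => valSize b ≤ valSize vs)
    (Nat.one_le_of_lt (length_lt_valSize vs)) fun b hb s hs => ?_
  split_ifs
  exacts [valSize_le_of_mem hs, hb]

theorem polyTime_bestSeed {vs S : α → List ℕ} {f : α → List ℕ → ℕ} (hvs : PolyTime vs)
    (hf : PolyTime fun x : α × List ℕ => f x.1 x.2) (hS : PolyTime S) :
    PolyTime fun a => bestSeed (vs a) (f a) (S a) := by
  have hadd : PolyTime fun x : α × ℕ => f x.1 (S x.1 ++ [x.2]) :=
    hf.comp (.pair .fst ((hS.comp .fst).append_singleton .snd))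
  refine .foldl hvs (.const 0) (.ite
    (.lt (hadd.comp (.pair .fst (.comp .fst .snd))) (hadd.comp (.pair .fst (.comp .snd .snd))))
    (.comp .snd .snd) (.comp .fst .snd)) hvs.1 fun a b s hs => ?_
  have := valSize_le_of_mem hs
  split_ifs <;> omega

theorem polyTime_greedyStep {vs S : α → List ℕ} {f : α → List ℕ → ℕ} {δ B : α → ℕ}
    (hvs : PolyTime vs) (hf : PolyTime fun x : α × List ℕ => f x.1 x.2) (hδ : PolyTime δ)
    (hB : PolyTime B) (hS : PolyTime S) :
    PolyTime fun a => greedyStep (vs a) (f a) (δ a) (B a) (S a) :=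
  have hadd := hS.append_singleton (polyTime_bestSeed hvs hf hS)
  .ite (hB.lt ((hS.length.add (.const 1)).mul hδ)) hS
    (.ite ((hf.comp (.pair .id hS)).lt (hf.comp (.pair .id hadd))) hadd hS)

theorem polyTime_greedySeeds {vs : α → List ℕ} {f : α → List ℕ → ℕ} {δ B : α → ℕ}
    (hvs : PolyTime vs) (hf : PolyTime fun x : α × List ℕ => f x.1 x.2) (hδ : PolyTime δ)
    (hB : PolyTime B) : PolyTime fun a => greedySeeds (vs a) (f a) (δ a) (B a) := by
  refine .foldl hvs (.const []) (polyTime_greedyStep (hvs.comp .fst)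
    (hf.comp (.pair (.comp .fst .fst) .snd)) (hδ.comp .fst) (hB.comp .fst) (.comp .fst .snd))
    ((PolyBounded.const 1).add hvs.1) fun a S _ _ => ?_
  have hbest := valSize_bestSeed_le (vs a) (f a) S
  have happend := valSize_append S [bestSeed (vs a) (f a) S]
  rw [valSize_cons, valSize_nil] at happend
  simp only [greedyStep]
  split_ifs <;> omega

theorem polyTime_maxExcess {rows : α → List (List ℕ)} (hrows : PolyTime rows) :
    PolyTime fun a => maxExcess (rows a) := by
  have hexcess : PolyTime fun x : (α × List ℕ) × ℕ => x.2 - x.1.2.getD 0 0 :=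
    .sub .snd (PolyTime.getD (.comp .snd .fst) (.const 0) (.const 0))
  exact (hrows.flatMap (.map .snd hexcess)).foldl_max

theorem polyTime_opposedVoters {rows : α → List (List ℕ)} (hrows : PolyTime rows) :
    PolyTime fun a => opposedVoters (rows a) := by
  have hrow : PolyTime fun x : α × ℕ => (rows x.1).getD x.2 [] :=
    (hrows.comp .fst).getD .snd (.const [])
  exact hrows.range_length.filter
    (hrow.any (((hrow.comp .fst).getD (.const 0) (.const 0)).lt .snd))

theorem polyTime_message {δ : α → ℕ} {l : α → List ℕ} (hδ : PolyTime δ) (hl : PolyTime l) :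
    PolyTime fun a => message (δ a) (l a).length :=
  hl.range_length.map (.pair (.ite (PolyTime.snd.eq (.const 0)) (hδ.comp .fst) (.const 0))
    (.const 0))

theorem polyTime_sampleValue :
    PolyTime fun x : (RawInput × List ℕ) × List ℕ => sampleValue x.1 x.2 := by
  have hinstance : PolyTime fun x : (RawInput × List ℕ) × List ℕ => x.1.1.1 :=
    .comp .fst (.comp .fst .fst)
  have hrows := PolyTime.fst.comp hinstance
  have hm : PolyTime fun x : (RawInput × List ℕ) × List ℕ =>
      List.range (bitCount x.1.1.1.1.length) :=
    .range_mul (.const (List.range 11)) hrows.range_length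
  have hN : PolyTime fun x : (RawInput × List ℕ) × List ℕ =>
      List.range (sampleCount x.1.1.1.1.length x.1.1.2.length) :=
    .range_mul (.range_mul (.const (List.range 648)) (hrows.range_length.range_pow 6))
      (.range_add (.range_add hrows.range_length (.const (List.range 1)))
        (PolyTime.snd.comp (.comp .fst .fst)).range_length)
  have hedges := PolyTime.fst.comp (PolyTime.snd.comp hinstance)
  exact polyTime_value hrows.range_length (polyTime_opposedVoters hrows)
    (polyTime_sampleGraphs (.comp .snd .fst) hm hrows.length hN hedges) .snd

theorem polyTime_algorithm : PolyTime algorithm := by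
  have hinstance : PolyTime fun x : RawInput × List ℕ => x.1.1 := .comp .fst .fst
  have hrows := PolyTime.fst.comp hinstance
  have hδ := polyTime_maxExcess hrows
  have hB := PolyTime.fst.comp (PolyTime.snd.comp (PolyTime.snd.comp hinstance))
  have hmessage := polyTime_message hδ (hrows.getD (.const 0) (.const []))
  exact (polyTime_greedySeeds hrows.range_length polyTime_sampleValue hδ hB).map
    (.pair .snd (hmessage.comp .fst))

end PolyTime

end GreedySampling

theorem Prog.initStore_one (v : Val) {k : ℕ} (r : Fin k → Bool) :
    Prog.initStore v r 1 = toVal ((List.ofFn r).map Bool.toNat) := by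
  simp only [initStore, toVal, List.map_map]
  rfl

theorem valSize_ofFn_toNat_le {k : ℕ} (r : Fin k → Bool) :
    valSize ((List.ofFn r).map Bool.toNat) ≤ 1 + k * 3 := by
  refine (valSize_le_of_forall_mem (w := 2) fun x hx => ?_).trans_eq (by simp)
  obtain ⟨b, -, rfl⟩ := List.mem_map.1 hx
  exact valSize_bool_le b

theorem PolyTime.exists_prog {α β : Type*} [ToVal α] [ToVal β] {f : α × List ℕ → β}
    (hf : PolyTime f) (coins : Polynomial ℕ) : ∃ (P : Prog) (steps : Polynomial ℕ),
      ∀ (a : α) (r : Fin (coins.eval (valSize a)) → Bool),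
        P.time (toVal a) r ≤ steps.eval (valSize a) ∧
        P.output (toVal a) r = toVal (f (a, (List.ofFn r).map Bool.toNat)) := by
  obtain ⟨-, Q, t, ⟨p, hp⟩, hQ⟩ := hf
  refine ⟨.seq (.assign 2 (.pair (.var 0) (.var 1))) (.seq (Q 2) (.assign 0 (.var 2))),
    p.comp (2 + .X + coins * 3) + 6, fun a r => ?_⟩
  set bits := (List.ofFn r).map Bool.toNat
  set σ := Prog.initStore (toVal a) r with hσ
  have hinput : Val.pair (σ 0) (σ 1) = toVal (a, bits) :=
    congrArg (Val.pair (toVal a)) (Prog.initStore_one _ r)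
  have hσ2 : Function.update σ 2 (toVal (a, bits)) 2 = toVal (a, bits) := Function.update_self ..
  constructor
  · have hsize : valSize (a, bits) ≤ 2 + valSize a + coins.eval (valSize a) * 3 := by
      have : valSize bits ≤ _ := valSize_ofFn_toNat_le r
      rw [valSize_pair]
      dsimp only
      omega
    have hbound : t (a, bits) ≤ p.eval _ := (hp _).trans (eval_mono_of_nat p hsize)
    have htime := (hQ (a, bits)).time_le hσ2
    simp only [Prog.time, Prog.run, PExpr.eval, PExpr.cost, ← hσ, hinput, Polynomial.eval_add,
      Polynomial.eval_comp, Polynomial.eval_mul, Polynomial.eval_X, Polynomial.eval_ofNat]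
    omega
  · simp only [Prog.output, Prog.run, PExpr.eval, ← hσ, hinput, Function.update_self,
      (hQ (a, bits)).result hσ2]

/-! ### Correctness of the algorithm -/

/-- Every entry of the list strictly increases `G` on the set of the entries before it. -/
inductive StrictChain {α : Type*} [DecidableEq α] (G : Finset α → ℕ) : List α → Prop
  | nil : StrictChain G []
  | snoc (S : List α) (s : α) : StrictChain G S → G S.toFinset < G (insert s S.toFinset) →
      StrictChain G (S ++ [s])

theorem StrictChain.nodup {α : Type*} [DecidableEq α] {G : Finset α → ℕ} {S : List α}
    (h : StrictChain G S) : S.Nodup := by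
  induction h with
  | nil => exact List.nodup_nil
  | snoc S s _ hs ih =>
    refine List.concat_eq_append ▸ ih.concat fun hmem => hs.ne ?_
    rw [Finset.insert_eq_of_mem (List.mem_toFinset.2 hmem)]

namespace GreedySampling

theorem bestSeed_spec {n : ℕ} (hn : 0 < n) (f : List ℕ → ℕ) (S : List ℕ) :
    bestSeed (List.range n) f S < n ∧
      ∀ t < n, f (S ++ [t]) ≤ f (S ++ [bestSeed (List.range n) f S]) := by
  have hfold : ∀ (l : List ℕ) (b : ℕ), b < n → (∀ t ∈ l, t < n) →
      let r := l.foldl (fun b s => if f (S ++ [b]) < f (S ++ [s]) then s else b) b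
      r < n ∧ f (S ++ [b]) ≤ f (S ++ [r]) ∧ ∀ t ∈ l, f (S ++ [t]) ≤ f (S ++ [r]) := by
    intro l
    induction l with
    | nil => intro b hb _; exact ⟨hb, le_rfl, by simp⟩
    | cons s l ih =>
      intro b hb hl
      rw [List.forall_mem_cons] at hl
      dsimp only
      rw [List.foldl_cons, List.forall_mem_cons]
      split_ifs with h
      · obtain ⟨hr, hs, hmax⟩ := ih s hl.1 hl.2
        exact ⟨hr, h.le.trans hs, hs, hmax⟩
      · obtain ⟨hr, hb, hmax⟩ := ih b hb hl.2
        exact ⟨hr, hb, (not_lt.1 h).trans hb, hmax⟩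
  obtain ⟨hr, -, hmax⟩ := hfold (List.range n) 0 hn fun t ht => List.mem_range.1 ht
  exact ⟨hr, fun t ht => hmax t (List.mem_range.2 ht)⟩

section Greedy

variable {n : ℕ} (hn : 0 < n) {f : List ℕ → ℕ} {G : Finset (Fin n) → ℕ}
  (hf : ∀ S : List (Fin n), f (S.map Fin.val) = G S.toFinset) {δ : ℕ} (hδ : 0 < δ) (B : ℕ)

include hδ in
theorem greedyStep_of_le {vs S : List ℕ} (hS : B / δ ≤ S.length) : greedyStep vs f δ B S = S := by
  rw [greedyStep, if_pos]
  rwa [← Nat.div_lt_iff_lt_mul hδ, Nat.lt_succ_iff]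

include hn hf hδ in
theorem exists_greedyStep_eq {S : List (Fin n)} (hS : S.length < B / δ) :
    ∃ b : Fin n, (∀ t, G (insert t S.toFinset) ≤ G (insert b S.toFinset)) ∧
      greedyStep (List.range n) f δ B (S.map Fin.val) =
        (if G S.toFinset < G (insert b S.toFinset) then S ++ [b] else S).map Fin.val := by
  have hadd : ∀ t : Fin n, f (S.map Fin.val ++ [t.val]) = G (insert t S.toFinset) := fun t => by
    rw [← toFinset_append_singleton, ← hf, List.map_append, List.map_singleton]
  have hbudget : ¬ B < ((S.map Fin.val).length + 1) * δ := by
    rwa [List.length_map, ← Nat.div_lt_iff_lt_mul hδ, Nat.lt_succ_iff, not_le]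
  obtain ⟨hb, hmax⟩ := bestSeed_spec hn f (S.map Fin.val)
  refine ⟨⟨_, hb⟩, fun t => ?_, ?_⟩
  · rw [← hadd, ← hadd]
    exact hmax t t.2
  · rw [greedyStep, if_neg hbudget, ← hf, ← hadd]
    split_ifs
    · rw [List.map_append, List.map_singleton]
    · rfl

include hn hf hδ in
theorem exists_greedySeeds_eq :
    ∃ (S : List (Fin n)) (K : ℕ), greedySeeds (List.range n) f δ B = S.map Fin.val ∧
      StrictChain G S ∧ S.length ≤ min (B / δ) n ∧ min (B / δ) n ≤ K ∧
      GreedyReachable (fun T => (G T : ℝ)) K S.toFinset := by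
  rw [greedySeeds, List.foldl_const, List.length_range]
  suffices h : ∀ j, ∃ (S : List (Fin n)) (K : ℕ),
      (greedyStep (List.range n) f δ B)^[j] [] = S.map Fin.val ∧ StrictChain G S ∧
      S.length ≤ min (B / δ) j ∧ min (B / δ) j ≤ K ∧
      GreedyReachable (fun T => (G T : ℝ)) K S.toFinset from h n
  intro j
  induction j with
  | zero => exact ⟨[], 0, rfl, .nil, by simp, by simp, .zero⟩
  | succ j ih =>
    obtain ⟨S, K, hstep, hchain, hlen, hK, hreach⟩ := ih
    rw [Function.iterate_succ_apply', hstep]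
    rcases le_or_gt (B / δ) S.length with hS | hS
    · exact ⟨S, K, greedyStep_of_le hδ B (by simpa using hS), hchain, by omega, by omega, hreach⟩
    obtain ⟨b, hmax, hb⟩ := exists_greedyStep_eq hn hf hδ B hS
    refine ⟨_, K + 1, hb, ?_⟩
    split_ifs with hlt
    · refine ⟨.snoc S b hchain hlt, by simp; omega, by omega, ?_⟩
      rw [toFinset_append_singleton]
      exact hreach.succ (Nat.cast_le.2 hlt.le) fun t => Nat.cast_le.2 (hmax t)
    · exact ⟨hchain, by omega, by omega,
        hreach.succ le_rfl fun t => Nat.cast_le.2 ((hmax t).trans (not_lt.1 hlt))⟩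

end Greedy

end GreedySampling

theorem apply_iterate_card_eq {V : Type*} [Fintype V] {g : Finset V → Finset V}
    (hg : ∀ X, X ⊆ g X) (X : Finset V) :
    g (g^[Fintype.card V] X) = g^[Fintype.card V] X := by
  have hsubset : ∀ t, g^[t] X ⊆ g^[t + 1] X := fun t =>
    (Function.iterate_succ_apply' g t X).symm ▸ hg _
  have heq : ∀ t, (g^[t] X).card = (g^[t + 1] X).card → g^[t] X = g^[t + 1] X := fun t h =>
    Finset.eq_of_subset_of_card_le (hsubset t) h.ge
  have hcard : (g^[Fintype.card V + 1] X).card = (g^[Fintype.card V] X).card :=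
    Nat.stabilises_of_monotone (f := fun t => (g^[t] X).card)
      (monotone_nat_of_le_succ fun t => Finset.card_le_card (hsubset t))
      (fun t => Finset.card_le_univ _)
      (fun t h => by
        simp only [Function.iterate_succ_apply' g (t + 1), ← heq t h,
          ← Function.iterate_succ_apply' g t])
      (Nat.le_succ _)
  rw [← Function.iterate_succ_apply' g, ← heq _ hcard.symm]

namespace ECSInstance

variable {I : ECSInstance}

theorem influenced_of_mem_cascade_snd {H : Finset (I.Voter × I.Voter)} {s v : I.Voter} {t : ℕ}
    (h : v ∈ (cascade H s t).2) : Influenced H s v := by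
  induction t with
  | zero => exact ⟨0, h⟩
  | succ t ih => exact (Finset.mem_union.1 h).elim ih fun h => ⟨t + 1, h⟩

theorem influenced_iff_reflTransGen {H : Finset (I.Voter × I.Voter)} {s v : I.Voter} :
    Influenced H s v ↔ Relation.ReflTransGen (fun u w => (u, w) ∈ H) s v := by
  constructor
  · rintro ⟨t, ht⟩
    induction t generalizing v with
    | zero => rw [Finset.mem_singleton.1 ht]
    | succ t ih =>
      obtain ⟨-, u, hu, huv⟩ := (Finset.mem_filter.1 ht).2
      exact (ih hu).tail huv
  · intro h
    induction h with
    | refl => exact ⟨0, Finset.mem_singleton_self s⟩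
    | @tail u w _ huw ih =>
      obtain ⟨t, ht⟩ := ih
      by_cases hw : w ∈ (cascade H s t).2
      · exact influenced_of_mem_cascade_snd hw
      · exact ⟨t + 1, Finset.mem_filter.2 ⟨Finset.mem_univ _, hw, u, ht, huw⟩⟩

/-- The vertices of `X` and their out-neighbors in the graph `H`: one round of the breadth-first
search, which forgets at what time a vertex is reached. -/
def spread (H : Finset (I.Voter × I.Voter)) (X : Finset I.Voter) : Finset I.Voter :=
  Finset.univ.filter fun v => v ∈ X ∨ ∃ u ∈ X, (u, v) ∈ H

theorem mem_spread {H : Finset (I.Voter × I.Voter)} {X : Finset I.Voter} {v : I.Voter} :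
    v ∈ spread H X ↔ v ∈ X ∨ ∃ u ∈ X, (u, v) ∈ H := by
  simp [spread]

theorem subset_spread (H : Finset (I.Voter × I.Voter)) (X : Finset I.Voter) : X ⊆ spread H X :=
  fun _ hv => mem_spread.2 (Or.inl hv)

theorem exists_influenced_of_mem_iterate_spread {H : Finset (I.Voter × I.Voter)}
    {X : Finset I.Voter} {t : ℕ} {v : I.Voter} (hv : v ∈ (spread H)^[t] X) :
    ∃ s ∈ X, Influenced H s v := by
  simp only [influenced_iff_reflTransGen]
  induction t generalizing v with
  | zero => exact ⟨v, hv, .refl⟩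
  | succ t ih =>
    rw [Function.iterate_succ_apply', mem_spread] at hv
    rcases hv with hv | ⟨u, hu, huv⟩
    · exact ih hv
    · obtain ⟨s, hs, hsu⟩ := ih hu
      exact ⟨s, hs, hsu.tail huv⟩

theorem mem_iterate_spread_of_influenced {H : Finset (I.Voter × I.Voter)} {X : Finset I.Voter}
    {s v : I.Voter} (hs : s ∈ X) (h : Influenced H s v) : v ∈ (spread H)^[I.n] X := by
  have hfix : spread H ((spread H)^[I.n] X) = (spread H)^[I.n] X := by
    simpa only [Fintype.card_fin] using apply_iterate_card_eq (subset_spread H) X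
  induction influenced_iff_reflTransGen.1 h with
  | refl => exact Function.id_le_iterate_of_id_le (subset_spread H) I.n X hs
  | tail hsu huv ih =>
    rw [← hfix, mem_spread]
    exact Or.inr ⟨_, ih (influenced_iff_reflTransGen.2 hsu), huv⟩

theorem mem_iterate_spread {H : Finset (I.Voter × I.Voter)} {X : Finset I.Voter} {v : I.Voter} :
    v ∈ (spread H)^[I.n] X ↔ ∃ s ∈ X, Influenced H s v :=
  ⟨exists_influenced_of_mem_iterate_spread, fun ⟨_, hs, h⟩ =>
    mem_iterate_spread_of_influenced hs h⟩

section RawInput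

open GreedySampling

/-- The edge `e` in the format of the algorithm, with its strength `q e` as a fraction. -/
def rawEdge (q : I.Voter × I.Voter → ℚ) (e : I.Voter × I.Voter) : Edge :=
  (e.1, e.2, (q e).num.toNat, (q e).den, 0)

/-- The edges in the order in which `ECSInstance.encode` lists them. -/
def edgeList (I : ECSInstance) : List (I.Voter × I.Voter) :=
  ((List.finRange I.n).product (List.finRange I.n)).filter fun e => decide (e ∈ I.E)

/-- The score vectors of the voters, in the format of the algorithm. -/
def scoreRows (I : ECSInstance) : List (List ℕ) :=
  (List.finRange I.n).map fun v => (List.finRange (I.ℓ + 1)).map fun c => I.score v c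

/-- The instance `I` with the strengths `q` and the confidence parameter `k`, in the format of the
algorithm. -/
def rawInput (I : ECSInstance) (q : I.Voter × I.Voter → ℚ) (k : ℕ) : RawInput :=
  ((I.scoreRows, I.edgeList.map (rawEdge q), I.B, 0), List.replicate k 0)

theorem toVal_rawInput (q : I.Voter × I.Voter → ℚ) (k : ℕ) :
    toVal (I.rawInput q k) = I.encodeInput q k := by
  have hscores : toVal I.scoreRows = Val.ofList ((List.finRange I.n).map fun v =>
      Val.ofList ((List.finRange (I.ℓ + 1)).map fun c => Val.num (I.score v c))) := by
    simp [toVal, scoreRows, Function.comp_def]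
  have hedges : toVal (I.edgeList.map (rawEdge q)) = Val.ofList (I.edgeList.map fun e =>
      Val.ofList [Val.num e.1, Val.num e.2, Val.num (q e).num.toNat, Val.num (q e).den]) := by
    simp only [toVal, List.map_map]
    rfl
  have hunary : toVal (List.replicate k 0) = Val.ofList (List.replicate k (Val.num 0)) := by
    simp [toVal]
  change Val.pair (Val.pair (toVal I.scoreRows) (Val.pair (toVal (I.edgeList.map (rawEdge q)))
    (Val.pair (Val.num I.B) (Val.num 0)))) (toVal (List.replicate k 0)) = _
  rw [hscores, hedges, hunary]
  rfl

theorem length_scoreRows (I : ECSInstance) : I.scoreRows.length = I.n := by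
  simp [scoreRows]

theorem getD_scoreRows (v : I.Voter) :
    I.scoreRows.getD v [] = (List.finRange (I.ℓ + 1)).map fun c => I.score v c := by
  simp [scoreRows, List.getD_eq_getElem?_getD]

theorem getD_scoreRow (v : I.Voter) :
    ((List.finRange (I.ℓ + 1)).map fun c => I.score v c).getD 0 0 = I.score v 0 := by
  simp [List.finRange_succ]

theorem opposedVoters_scoreRows (I : ECSInstance) :
    opposedVoters I.scoreRows =
      ((List.finRange I.n).filter fun v => decide (v ∈ I.opposed)).map Fin.val := by
  rw [opposedVoters, length_scoreRows, ← List.map_coe_finRange_eq_range, List.filter_map]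
  congr 1
  refine List.filter_congr fun v _ => ?_
  rw [Bool.eq_iff_iff]
  simp only [Function.comp_apply, getD_scoreRows, getD_scoreRow]
  simp [mem_opposed]

theorem foldl_max_le_iff {l : List ℕ} {a m : ℕ} :
    l.foldl max a ≤ m ↔ a ≤ m ∧ ∀ x ∈ l, x ≤ m := by
  induction l generalizing a with
  | nil => simp
  | cons b l ih => rw [List.foldl_cons, ih, max_le_iff, List.forall_mem_cons, and_assoc]

theorem maxExcess_scoreRows : maxExcess I.scoreRows = I.delta.toNat := by
  refine eq_of_forall_ge_iff fun m => ?_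
  have hentry (v : I.Voter) (c : I.Candidate) :
      I.score v c - I.score v 0 ≤ m ↔ (I.score v c : ℤ) - I.score v 0 ≤ m := by omega
  have hexcess : maxExcess I.scoreRows ≤ m ↔
      ∀ v c, (I.score v c : ℤ) - I.score v 0 ≤ m := by
    rw [maxExcess, foldl_max_le_iff, scoreRows, List.flatMap_map]
    simp only [getD_scoreRow, List.map_map, List.forall_mem_flatMap, List.forall_mem_map,
      List.mem_finRange, forall_true_left, Function.comp_apply, hentry, Nat.zero_le, true_and]
  have hdelta : I.delta.toNat ≤ m ↔ ∀ v c, c ≠ 0 → (I.score v c : ℤ) - I.score v 0 ≤ m := by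
    simp [delta, Finset.sup'_le_iff]
  rw [hexcess, hdelta]
  refine forall_congr' fun v => ⟨fun h c _ => h c, fun h c => ?_⟩
  rcases eq_or_ne c 0 with rfl | hc
  exacts [by simp, h c hc]

theorem mem_reach (q : I.Voter × I.Voter → ℚ) (H : List (I.Voter × I.Voter)) (S : List I.Voter)
    (v : I.Voter) :
    (v : ℕ) ∈ reach (List.range I.n) (H.map (rawEdge q)) (S.map Fin.val) ↔
      ∃ s ∈ S.toFinset, Influenced H.toFinset s v := by
  let toFin : List ℕ → Finset I.Voter := fun R => Finset.univ.filter fun v => (v : ℕ) ∈ R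
  have hstep : Function.Semiconj toFin (reachStep (List.range I.n) (H.map (rawEdge q)))
      (spread H.toFinset) := by
    intro R
    ext v
    simp only [toFin, reachStep, mem_spread, Finset.mem_filter, Finset.mem_univ, true_and,
      List.mem_filter, List.mem_range, Fin.is_lt, Bool.or_eq_true, List.contains_iff_mem,
      List.any_eq_true, List.mem_map, Bool.and_eq_true, decide_eq_true_eq, List.mem_toFinset]
    refine or_congr_right ⟨?_, fun ⟨u, hu, he⟩ => ⟨_, ⟨(u, v), he, rfl⟩, hu, rfl⟩⟩
    rintro ⟨_, ⟨⟨u, w⟩, he, rfl⟩, hu, hw⟩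
    obtain rfl : w = v := Fin.ext hw
    exact ⟨u, hu, he⟩
  have hS : toFin (S.map Fin.val) = S.toFinset := by
    ext v
    simp [toFin, Fin.val_inj]
  rw [← mem_iterate_spread, ← hS, ← hstep.iterate_right, reach, List.foldl_const,
    List.length_range]
  simp [toFin]

theorem value_eq (q : I.Voter × I.Voter → ℚ) (Gs : List (List (I.Voter × I.Voter)))
    (S : List I.Voter) :
    value (List.range I.n) (opposedVoters I.scoreRows) (Gs.map fun H => H.map (rawEdge q))
      (S.map Fin.val) = (Gs.map fun H => (I.covered H.toFinset S.toFinset).card).sum := by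
  rw [value, List.map_map]
  congr 1
  refine List.map_congr_left fun H _ => ?_
  rw [Function.comp_apply, opposedVoters_scoreRows, List.filter_map, List.length_map,
    List.filter_filter, ← List.toFinset_card_of_nodup ((List.nodup_finRange _).filter _)]
  congr 1
  ext v
  simp [mem_covered, mem_reach, and_comm]

end RawInput

end ECSInstance

/-! ### Averages over finite types -/

open scoped BigOperators

section Expect

variable {Ω Ω' κ κ' : Type*} [Fintype Ω] [Fintype Ω'] [Fintype κ] [Fintype κ']

theorem expect_pi_prod [DecidableEq κ] (f : κ → Ω → ℝ) :
    𝔼 y : κ → Ω, ∏ i, f i (y i) = ∏ i, 𝔼 ω, f i ω := by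
  simp only [Fintype.expect_eq_sum_div_card, Finset.prod_div_distrib, Finset.prod_univ_sum,
    Fintype.piFinset_univ, Fintype.card_pi, Nat.cast_prod]

theorem expect_comp_fst [Nonempty Ω'] (f : Ω → ℝ) : 𝔼 x : Ω × Ω', f x.1 = 𝔼 ω, f ω := by
  rw [← Finset.univ_product_univ, Finset.expect_product]
  simp only [Fintype.expect_const]

theorem expect_comp_injective [DecidableEq κ] [DecidableEq κ'] [Nonempty Ω] {ι : κ' → κ}
    (hι : Function.Injective ι) (f : (κ' → Ω) → ℝ) :
    𝔼 ω : κ → Ω, f (ω ∘ ι) = 𝔼 y, f y := by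
  classical
  let split := Equiv.piEquivPiSubtypeProd (· ∈ Set.range ι) fun _ : κ => Ω
  let reindex : ({x // x ∈ Set.range ι} → Ω) ≃ (κ' → Ω) :=
    (Equiv.ofInjective ι hι).symm.arrowCongr (Equiv.refl Ω)
  calc 𝔼 ω : κ → Ω, f (ω ∘ ι) = 𝔼 x, f (reindex (split x).1) := rfl
    _ = 𝔼 x, f (reindex x.1) := Fintype.expect_equiv split _ _ fun _ => rfl
    _ = 𝔼 x, f (reindex x) := expect_comp_fst fun x => f (reindex x)
    _ = 𝔼 y, f y := Fintype.expect_equiv reindex _ _ fun _ => rfl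

section Filter

variable [DecidableEq κ] (P : κ → Ω → Prop) [∀ e, DecidablePred (P e)]

omit [Fintype Ω] in
theorem ite_filter_eq_eq_prod {s H : Finset κ} (hH : H ⊆ s) (y : κ → Ω) :
    (if s.filter (fun e => P e (y e)) = H then (1 : ℝ) else 0) =
      ∏ e, if e ∈ H then (if P e (y e) then 1 else 0)
        else if e ∈ s then (1 - if P e (y e) then 1 else 0) else 1 := by
  split_ifs with h
  · subst h
    refine (Finset.prod_eq_one fun e _ => ?_).symm
    by_cases hs : e ∈ s <;> by_cases hP : P e (y e) <;> simp [hs, hP]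
  · obtain ⟨e, he⟩ : ∃ e, ¬(e ∈ s.filter (fun e => P e (y e)) ↔ e ∈ H) := by
      simpa [Finset.ext_iff] using h
    refine (Finset.prod_eq_zero (Finset.mem_univ e) ?_).symm
    have hHs : e ∈ H → e ∈ s := fun h => hH h
    by_cases hs : e ∈ s <;> by_cases hP : P e (y e) <;> by_cases heH : e ∈ H <;> simp_all

theorem expect_ite_filter_eq [Nonempty Ω] {s H : Finset κ} (hH : H ⊆ s) :
    𝔼 y : κ → Ω, (if s.filter (fun e => P e (y e)) = H then (1 : ℝ) else 0) =
      subsetProb (fun e => 𝔼 ω, if P e ω then (1 : ℝ) else 0) s H := by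
  simp only [ite_filter_eq_eq_prod P hH]
  rw [expect_pi_prod fun e ω => if e ∈ H then (if P e ω then (1 : ℝ) else 0)
    else if e ∈ s then (1 - if P e ω then (1 : ℝ) else 0) else 1, subsetProb,
    ← Finset.prod_ite_mem_eq H, ← Finset.prod_ite_mem_eq (s \ H), ← Finset.prod_mul_distrib]
  refine Finset.prod_congr rfl fun e _ => ?_
  by_cases heH : e ∈ H <;> by_cases hes : e ∈ s <;>
    simp [heH, hes, Finset.expect_sub_distrib]

theorem expect_filter [Nonempty Ω] (s : Finset κ) (g : Finset κ → ℝ) :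
    𝔼 y : κ → Ω, g (s.filter fun e => P e (y e)) =
      subsetExpect (fun e => 𝔼 ω, if P e ω then (1 : ℝ) else 0) s g := by
  have hsum (y : κ → Ω) : g (s.filter fun e => P e (y e)) =
      ∑ H ∈ s.powerset, (if s.filter (fun e => P e (y e)) = H then (1 : ℝ) else 0) * g H := by
    simp [Finset.filter_subset]
  simp only [hsum]
  rw [Finset.expect_sum_comm, subsetExpect]
  refine Finset.sum_congr rfl fun H hH => ?_
  rw [← Finset.expect_mul, expect_ite_filter_eq P (Finset.mem_powerset.1 hH)]

end Filter

open MeasureTheory ProbabilityTheory in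
theorem integral_uniformOn_univ [MeasurableSpace Ω] [MeasurableSingletonClass Ω] (f : Ω → ℝ) :
    ∫ ω, f ω ∂uniformOn Set.univ = 𝔼 ω, f ω := by
  rw [integral_fintype .of_finite, Fintype.expect_eq_sum_div_card, Finset.sum_div]
  refine Finset.sum_congr rfl fun ω _ => ?_
  rw [measureReal_def, uniformOn_univ, Measure.count_singleton]
  simp [div_eq_inv_mul]

open MeasureTheory ProbabilityTheory in
theorem hasSubgaussianMGF_sub_expect [Nonempty Ω] [MeasurableSpace Ω] [MeasurableSingletonClass Ω]
    {f : Ω → ℝ} (hf : ∀ ω, f ω ∈ Set.Icc (0 : ℝ) 1) :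
    HasSubgaussianMGF (fun ω => f ω - 𝔼 ω', f ω') (1 / 4) (uniformOn Set.univ) := by
  have h := hasSubgaussianMGF_of_mem_Icc (μ := uniformOn Set.univ)
    (measurable_of_finite f).aemeasurable (.of_forall hf)
  rw [integral_uniformOn_univ] at h
  convert h using 1
  norm_num [div_pow]

open MeasureTheory ProbabilityTheory in
theorem expect_sum_sub_expect_ge_le [DecidableEq κ] [Nonempty Ω] {f : Ω → ℝ}
    (hf : ∀ ω, f ω ∈ Set.Icc (0 : ℝ) 1) {ε : ℝ} (hε : 0 ≤ ε) :
    𝔼 y : κ → Ω, (if ε ≤ ∑ i, (f (y i) - 𝔼 ω, f ω) then (1 : ℝ) else 0) ≤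
      Real.exp (-(2 * ε ^ 2 / Fintype.card κ)) := by
  let : MeasurableSpace Ω := ⊤
  let μ : κ → Measure Ω := fun _ => uniformOn Set.univ
  have huniform : uniformOn Set.univ = Measure.pi μ := by
    rw [← Set.pi_univ Set.univ]
    exact uniformOn_pi
  have hindep : iIndepFun (fun i y => f (y i) - 𝔼 ω, f ω) (Measure.pi μ) :=
    iIndepFun_pi fun _ => (measurable_of_finite fun ω => f ω - 𝔼 ω, f ω).aemeasurable
  have hsubG (i : κ) : HasSubgaussianMGF (fun y => f (y i) - 𝔼 ω, f ω) (1 / 4) (Measure.pi μ) := by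
    refine .of_map (measurable_pi_apply i).aemeasurable (X := fun ω => f ω - 𝔼 ω, f ω) ?_
    rw [(measurePreserving_eval μ i).map_eq]
    exact hasSubgaussianMGF_sub_expect hf
  calc 𝔼 y : κ → Ω, (if ε ≤ ∑ i, (f (y i) - 𝔼 ω, f ω) then (1 : ℝ) else 0)
      = (Measure.pi μ).real {y | ε ≤ ∑ i, (f (y i) - 𝔼 ω, f ω)} := by
        rw [← huniform, ← integral_uniformOn_univ, ← integral_indicator_one (.of_discrete)]
        rfl
    _ ≤ Real.exp (-ε ^ 2 / (2 * (∑ _i : κ, 1 / 4 : NNReal))) :=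
        HasSubgaussianMGF.measure_sum_ge_le_of_iIndepFun hindep (fun i _ => hsubG i) hε
    _ = Real.exp (-(2 * ε ^ 2 / Fintype.card κ)) := by
        congr 1
        push_cast
        simp only [Finset.sum_const, Finset.card_univ, nsmul_eq_mul]
        ring

theorem expect_abs_sum_sub_expect_ge_le [DecidableEq κ] [Nonempty Ω] {f : Ω → ℝ}
    (hf : ∀ ω, f ω ∈ Set.Icc (0 : ℝ) 1) {ε : ℝ} (hε : 0 ≤ ε) :
    𝔼 y : κ → Ω, (if ε ≤ |∑ i, (f (y i) - 𝔼 ω, f ω)| then (1 : ℝ) else 0) ≤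
      2 * Real.exp (-(2 * ε ^ 2 / Fintype.card κ)) := by
  have hf' (ω) : 1 - f ω ∈ Set.Icc (0 : ℝ) 1 :=
    ⟨sub_nonneg.2 (hf ω).2, sub_le_self _ (hf ω).1⟩
  have hneg (y : κ → Ω) : ∑ i, ((1 - f (y i)) - 𝔼 ω, (1 - f ω)) = -∑ i, (f (y i) - 𝔼 ω, f ω) := by
    rw [Finset.expect_sub_distrib, Fintype.expect_const, ← Finset.sum_neg_distrib]
    exact Finset.sum_congr rfl fun i _ => by ring
  have hupper := expect_sum_sub_expect_ge_le (κ := κ) hf hε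
  have hlower := expect_sum_sub_expect_ge_le (κ := κ) hf' hε
  simp only [hneg] at hlower
  rw [two_mul]
  refine le_trans ?_ (add_le_add hupper hlower)
  rw [← Finset.expect_add_distrib]
  refine Finset.expect_le_expect fun y _ => ?_
  generalize ∑ i, (f (y i) - 𝔼 ω, f ω) = z
  by_cases hpos : ε ≤ z <;> by_cases hneg : ε ≤ -z <;> simp [le_abs, hpos, hneg]

end Expect

open Classical in
theorem coinProb_eq_expect {k : ℕ} (A : Set (Fin k → Bool)) :
    coinProb A = 𝔼 ω, if ω ∈ A then (1 : ℝ) else 0 := by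
  rw [coinProb, Fintype.expect_eq_sum_div_card, Finset.sum_boole, Set.ncard_eq_toFinset_card']
  simp

section RandomBits

theorem abs_sub_expect_lt_mul_le {M : ℕ} (hM : 0 < M) {p : ℝ} (hp : p ∈ Set.Icc (0 : ℝ) 1) :
    |p - 𝔼 x : Fin M, (if (x : ℝ) < p * M then (1 : ℝ) else 0)| ≤ 1 / M := by
  have hM' : (0 : ℝ) < M := Nat.cast_pos.2 hM
  have hceil : ⌈p * M⌉₊ ≤ M := Nat.ceil_le.2 (mul_le_of_le_one_left hM'.le hp.2)
  have hcard : 𝔼 x : Fin M, (if (x : ℝ) < p * M then (1 : ℝ) else 0) = ⌈p * M⌉₊ / M := by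
    rw [Fintype.expect_eq_sum_div_card, Finset.sum_boole, Fintype.card_fin]
    simp only [← Nat.lt_ceil, Fin.card_filter_val_lt, min_eq_right hceil]
  have hround : |p * M - ⌈p * M⌉₊| ≤ 1 := abs_le.2
    ⟨by linarith [Nat.ceil_lt_add_one (mul_nonneg hp.1 hM'.le)], by linarith [Nat.le_ceil (p * M)]⟩
  calc |p - 𝔼 x : Fin M, (if (x : ℝ) < p * M then (1 : ℝ) else 0)|
      = |p * M - ⌈p * M⌉₊| / M := by
        rw [hcard, ← abs_of_pos hM', ← abs_div, abs_of_pos hM', sub_div,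
          mul_div_cancel_right₀ _ hM'.ne']
    _ ≤ 1 / M := by gcongr

/-- The number with the given binary digits, the most significant one first. -/
def ofBits (m : ℕ) : (Fin m → Bool) ≃ Fin (2 ^ m) :=
  (Fin.revPerm.arrowCongr finTwoEquiv.symm).trans finFunctionFinEquiv

theorem foldl_range_two_mul_add (f : ℕ → ℕ) (m : ℕ) :
    (List.range m).foldl (fun c b => 2 * c + f b) 0 =
      ∑ b ∈ Finset.range m, f (m - (b + 1)) * 2 ^ b := by
  induction m with
  | zero => rfl
  | succ m ih =>
    rw [List.range_succ, List.foldl_append, ih, Finset.sum_range_succ', List.foldl_cons,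
      List.foldl_nil, Finset.mul_sum]
    simp [pow_succ', mul_left_comm]

theorem draw_eq_ofBits {C : ℕ} (r : Fin C → Bool) {m i : ℕ} (h : ∀ b : Fin m, i * m + b < C) :
    GreedySampling.draw ((List.ofFn r).map Bool.toNat) m i =
      ofBits m fun b => r ⟨i * m + b, h b⟩ := by
  rw [GreedySampling.draw, foldl_range_two_mul_add, Finset.sum_range, ofBits, Equiv.trans_apply,
    finFunctionFinEquiv_apply]
  refine Finset.sum_congr rfl fun b _ => congrArg (· * 2 ^ (b : ℕ)) ?_
  have hb := h b.rev
  have hdigit (a : Bool) : (finTwoEquiv.symm a : ℕ) = a.toNat := by cases a <;> rfl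
  rw [Equiv.arrowCongr_apply, Function.comp_apply, Function.comp_apply, hdigit]
  rw [Fin.val_rev] at hb
  simp [List.getD_eq_getElem?_getD, hb, Fin.rev]

theorem abs_sub_expect_ofBits_lt_mul_le (m : ℕ) {p : ℝ} (hp : p ∈ Set.Icc (0 : ℝ) 1) :
    |p - 𝔼 x : Fin m → Bool, (if (ofBits m x : ℝ) < p * 2 ^ m then (1 : ℝ) else 0)| ≤
      1 / 2 ^ m := by
  rw [Fintype.expect_equiv (ofBits m) _
    (fun x : Fin (2 ^ m) => if (x : ℝ) < p * 2 ^ m then (1 : ℝ) else 0) fun _ => rfl]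
  exact_mod_cast abs_sub_expect_lt_mul_le (Nat.two_pow_pos m) hp

/-- The position of a random bit, given by the sample, the edge and the digit for which it is used,
in the order in which `GreedySampling.isLive` reads the bits. -/
def coinIndex {N n m C : ℕ} (h : N * n * n * m ≤ C) (x : Fin N × (Fin n × Fin n) × Fin m) :
    Fin C :=
  (finProdFinEquiv (finProdFinEquiv (finProdFinEquiv (x.1, x.2.1.1), x.2.1.2), x.2.2)).castLE h

variable {N n m C : ℕ} (h : N * n * n * m ≤ C)

theorem coinIndex_injective : Function.Injective (coinIndex h) := by
  rintro ⟨i, ⟨u, v⟩, b⟩ ⟨i', ⟨u', v'⟩, b'⟩ heq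
  simp only [coinIndex, Fin.castLE_inj, EmbeddingLike.apply_eq_iff_eq, Prod.mk.injEq] at heq
  simp [heq]

theorem val_coinIndex (i : Fin N) (u v : Fin n) (b : Fin m) :
    (coinIndex h (i, (u, v), b) : ℕ) = ((i * n + u) * n + v) * m + b := by
  simp only [coinIndex, Fin.val_castLE, finProdFinEquiv_apply_val]
  ring

/-- The random bits, arranged by samples, edges and digits. -/
def coinTable (r : Fin C → Bool) (i : Fin N) (e : Fin n × Fin n) (b : Fin m) : Bool :=
  r (coinIndex h (i, e, b))

theorem expect_coinTable (f : (Fin N → Fin n × Fin n → Fin m → Bool) → ℝ) :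
    𝔼 r : Fin C → Bool, f (coinTable h r) = 𝔼 y, f y := by
  let arrange : (Fin N × (Fin n × Fin n) × Fin m → Bool) ≃ (Fin N → Fin n × Fin n → Fin m → Bool) :=
    (Equiv.curry _ _ _).trans ((Equiv.refl _).arrowCongr (Equiv.curry _ _ _))
  calc 𝔼 r : Fin C → Bool, f (coinTable h r)
      = 𝔼 r : Fin C → Bool, f (arrange (r ∘ coinIndex h)) := rfl
    _ = 𝔼 x, f (arrange x) := expect_comp_injective (coinIndex_injective h) fun x => f (arrange x)
    _ = 𝔼 y, f y := Fintype.expect_equiv arrange _ _ fun _ => rfl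

end RandomBits

/-! ### Sampled live graphs -/

namespace ECSInstance

open GreedySampling

variable {I : ECSInstance}

open Classical in
/-- The live graph for the random bits `ω`: the bits of every edge are read as a number, and the
edge is live if this number is below the accordingly scaled strength. -/
noncomputable def drawGraph {m : ℕ} (ω : I.Voter × I.Voter → Fin m → Bool) :
    Finset (I.Voter × I.Voter) :=
  I.E.filter fun e => (ofBits m (ω e) : ℝ) < I.p e * 2 ^ m

/-- The number of covered voters, summed over the samples. -/
noncomputable def sampleCover {N m : ℕ} (y : Fin N → I.Voter × I.Voter → Fin m → Bool)
    (T : Finset I.Voter) : ℕ :=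
  ∑ i, (I.covered (drawGraph (y i)) T).card

theorem isMonotoneSubmodular_sampleCover {N m : ℕ}
    (y : Fin N → I.Voter × I.Voter → Fin m → Bool) :
    IsMonotoneSubmodular fun T => (sampleCover y T : ℝ) := by
  have h := IsMonotoneSubmodular.sum_mul (s := Finset.univ) (w := fun _ : Fin N => (1 : ℝ))
    (fun _ _ => zero_le_one) fun i _ => isMonotoneSubmodular_card_covered (drawGraph (y i))
  simpa only [sampleCover, Nat.cast_sum, one_mul] using h

theorem liveProb_drawGraph_pos {m : ℕ} (ω : I.Voter × I.Voter → Fin m → Bool) :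
    0 < I.liveProb (drawGraph ω) := by
  have hpow : (0 : ℝ) < 2 ^ m := by positivity
  refine mul_pos (Finset.prod_pos fun e he => ?_) (Finset.prod_pos fun e he => ?_)
  · have hlive := (Finset.mem_filter.1 he).2
    exact pos_of_mul_pos_left ((Nat.cast_nonneg _).trans_lt hlive) hpow.le
  · obtain ⟨heE, hdead⟩ := Finset.mem_sdiff.1 he
    have hle : I.p e * 2 ^ m ≤ ofBits m (ω e) :=
      not_lt.1 fun hlive => hdead (Finset.mem_filter.2 ⟨heE, hlive⟩)
    have hlt : ((ofBits m (ω e) : ℕ) : ℝ) < 2 ^ m := by exact_mod_cast (ofBits m (ω e)).2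
    exact sub_pos.2 ((mul_lt_iff_lt_one_left hpow).1 (hle.trans_lt hlt))

theorem expCover_lt_of_sampleCover_lt {N m : ℕ} {y : Fin N → I.Voter × I.Voter → Fin m → Bool}
    {S T : Finset I.Voter} (hST : S ⊆ T) (h : sampleCover y S < sampleCover y T) :
    I.expCover S < I.expCover T := by
  obtain ⟨i, -, hi⟩ := Finset.exists_lt_of_sum_lt h
  refine Finset.sum_lt_sum (fun H hH => mul_le_mul_of_nonneg_left
      ((isMonotoneSubmodular_card_covered H).mono hST)
      (subsetProb_nonneg (fun e _ => I.p_mem_Icc e) (Finset.mem_powerset.1 hH)))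
    ⟨drawGraph (y i), Finset.mem_powerset.2 (Finset.filter_subset _ _), ?_⟩
  exact mul_lt_mul_of_pos_left (Nat.cast_lt.2 hi) (liveProb_drawGraph_pos (y i))

theorem greedyBuilt_deltaPlan (hδ : 0 < I.delta) {N m : ℕ}
    {y : Fin N → I.Voter × I.Voter → Fin m → Bool} {S : List I.Voter}
    (hS : StrictChain (sampleCover y) S) : I.GreedyBuilt (I.deltaPlan S) := by
  induction hS with
  | nil => exact .nil
  | snoc S s _ hlt ih =>
    have hnew : s ∉ S := fun hs =>
      hlt.ne (by rw [Finset.insert_eq_of_mem (List.mem_toFinset.2 hs)])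
    have hsnoc : I.deltaPlan (S ++ [s]) = I.deltaPlan S ++ [(s, Pi.single 0 I.delta)] := by
      simp only [deltaPlan, List.map_append, List.map_cons, List.map_nil]
    rw [hsnoc]
    refine .snoc _ _ ih ⟨by rwa [seeds_deltaPlan], Or.inr ?_⟩
    rw [← hsnoc, expVotes_deltaPlan hδ, expVotes_deltaPlan hδ, toFinset_append_singleton]
    exact (add_lt_add_iff_left _).2
      (expCover_lt_of_sampleCover_lt (Finset.subset_insert _ _) hlt)

section Accuracy

theorem card_covered_le (H : Finset (I.Voter × I.Voter)) (T : Finset I.Voter) :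
    (I.covered H T).card ≤ I.n :=
  card_finset_fin_le _

theorem abs_expCover_sub_expect_le (m : ℕ) (T : Finset I.Voter) :
    |I.expCover T - 𝔼 ω : I.Voter × I.Voter → Fin m → Bool,
      ((I.covered (drawGraph ω) T).card : ℝ)| ≤ (I.n : ℝ) ^ 3 / 2 ^ m := by
  classical
  have hcard : (I.E.card : ℝ) ≤ I.n ^ 2 := by
    have h := Finset.card_le_univ I.E
    rw [Fintype.card_prod, Fintype.card_fin, ← sq] at h
    exact_mod_cast h
  have hprob (e : I.Voter × I.Voter) : 𝔼 x : Fin m → Bool,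
      (if (ofBits m x : ℝ) < I.p e * 2 ^ m then (1 : ℝ) else 0) ∈ Set.Icc (0 : ℝ) 1 := by
    have hind (x : Fin m → Bool) :
        (if (ofBits m x : ℝ) < I.p e * 2 ^ m then (1 : ℝ) else 0) ∈ Set.Icc (0 : ℝ) 1 := by
      split_ifs <;> norm_num
    exact ⟨Finset.expect_nonneg fun x _ => (hind x).1,
      Finset.expect_le Finset.univ_nonempty fun x _ => (hind x).2⟩
  have hfilter := expect_filter (fun e x => (ofBits m x : ℝ) < I.p e * 2 ^ m) I.E
    fun H => ((I.covered H T).card : ℝ)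
  calc |I.expCover T - 𝔼 ω : I.Voter × I.Voter → Fin m → Bool,
        ((I.covered (drawGraph ω) T).card : ℝ)|
      ≤ (∑ e ∈ I.E, |I.p e - 𝔼 x : Fin m → Bool,
          (if (ofBits m x : ℝ) < I.p e * 2 ^ m then (1 : ℝ) else 0)|) * I.n := by
        rw [expCover, expect_eq_subsetExpect]
        simp only [drawGraph]
        rw [hfilter]
        exact abs_subsetExpect_sub_le (fun e _ => I.p_mem_Icc e) (fun e _ => hprob e)
          fun H => ⟨Nat.cast_nonneg _, Nat.cast_le.2 (card_covered_le H T)⟩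
    _ ≤ (∑ _e ∈ I.E, 1 / 2 ^ m) * I.n := by
        gcongr with e
        exact abs_sub_expect_ofBits_lt_mul_le m (I.p_mem_Icc e)
    _ ≤ I.n ^ 2 * (1 / 2 ^ m) * I.n := by
        rw [Finset.sum_const, nsmul_eq_mul]
        gcongr
    _ = I.n ^ 3 / 2 ^ m := by ring

theorem pow_three_div_two_pow_bitCount_le {n : ℕ} (hn : 0 < n) :
    (n : ℝ) ^ 3 / 2 ^ bitCount n ≤ 1 / (36 * (n : ℝ) ^ 2) := by
  have hpow : 36 * n ^ 5 ≤ 2 ^ bitCount n :=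
    calc 36 * n ^ 5 ≤ (2 ^ n) ^ 6 * (2 ^ n) ^ 5 := by
          gcongr
          · exact (show 36 ≤ 2 ^ 6 by norm_num).trans
              (Nat.pow_le_pow_left (Nat.le_self_pow hn.ne' 2) 6)
          · exact Nat.lt_two_pow_self.le
      _ = 2 ^ bitCount n := by rw [← pow_add, ← pow_mul, bitCount, mul_comm n]
  have : (0 : ℝ) < n := Nat.cast_pos.2 hn
  rw [div_le_div_iff₀ (by positivity) (by positivity), one_mul]
  calc (n : ℝ) ^ 3 * (36 * n ^ 2) = 36 * n ^ 5 := by ring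
    _ ≤ 2 ^ bitCount n := by exact_mod_cast hpow

/-- The mean of the sampled coverage is close to the expected coverage, for all seed sets at once.
The margin is half of the surplus `1 / (9 * n ^ 2)` in `div_mul_one_sub_one_div_exp_add_le`. -/
def Accurate {N m : ℕ} (y : Fin N → I.Voter × I.Voter → Fin m → Bool) : Prop :=
  ∀ T : Finset I.Voter, |sampleCover y T - N * I.expCover T| ≤ N * (1 / (18 * (I.n : ℝ) ^ 2))

theorem accurate_of_abs_sum_le {N : ℕ} {y : Fin N → I.Voter × I.Voter → Fin (bitCount I.n) → Bool}
    (h : ∀ T, |∑ i, (((I.covered (drawGraph (y i)) T).card : ℝ) -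
      𝔼 ω : I.Voter × I.Voter → Fin (bitCount I.n) → Bool,
        ((I.covered (drawGraph ω) T).card : ℝ))| ≤ N * (1 / (36 * (I.n : ℝ) ^ 2))) :
    Accurate y := by
  intro T
  set μ := 𝔼 ω : I.Voter × I.Voter → Fin (bitCount I.n) → Bool,
    ((I.covered (drawGraph ω) T).card : ℝ)
  have hsampling : |sampleCover y T - N * μ| ≤ N * (1 / (36 * (I.n : ℝ) ^ 2)) := by
    simpa [sampleCover] using h T
  have hrounding : |N * μ - N * I.expCover T| ≤ N * (1 / (36 * (I.n : ℝ) ^ 2)) := by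
    rw [← mul_sub, abs_mul, Nat.abs_cast, abs_sub_comm]
    gcongr
    exact (abs_expCover_sub_expect_le _ T).trans (pow_three_div_two_pow_bitCount_le I.n_pos)
  calc |sampleCover y T - N * I.expCover T|
      ≤ |sampleCover y T - N * μ| + |N * μ - N * I.expCover T| := abs_sub_le _ _ _
    _ ≤ N * (1 / (36 * (I.n : ℝ) ^ 2)) + N * (1 / (36 * (I.n : ℝ) ^ 2)) :=
        add_le_add hsampling hrounding
    _ = N * (1 / (18 * (I.n : ℝ) ^ 2)) := by
        field_simp
        norm_num [mul_assoc]

theorem expect_abs_sum_card_covered_ge_le (k m : ℕ) (T : Finset I.Voter) :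
    𝔼 y : Fin (sampleCount I.n k) → I.Voter × I.Voter → Fin m → Bool,
      (if sampleCount I.n k * (1 / (36 * (I.n : ℝ) ^ 2)) ≤
          |∑ i, (((I.covered (drawGraph (y i)) T).card : ℝ) -
            𝔼 ω : I.Voter × I.Voter → Fin m → Bool, ((I.covered (drawGraph ω) T).card : ℝ))|
        then (1 : ℝ) else 0) ≤ 2 * Real.exp (-(I.n + 1 + k : ℕ)) := by
  have hn : (0 : ℝ) < I.n := Nat.cast_pos.2 I.n_pos
  have hmem (ω : I.Voter × I.Voter → Fin m → Bool) :
      ((I.covered (drawGraph ω) T).card : ℝ) / I.n ∈ Set.Icc (0 : ℝ) 1 :=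
    ⟨by positivity, div_le_one_of_le₀ (Nat.cast_le.2 (card_covered_le _ T)) hn.le⟩
  have hoeffding := expect_abs_sum_sub_expect_ge_le (κ := Fin (sampleCount I.n k)) hmem
    (ε := sampleCount I.n k * (1 / (36 * (I.n : ℝ) ^ 2)) / I.n) (by positivity)
  simp only [← Finset.expect_div, ← sub_div, ← Finset.sum_div, abs_div, Nat.abs_cast,
    div_le_div_iff_of_pos_right hn] at hoeffding
  refine hoeffding.trans_eq ?_
  congr 3
  rw [Fintype.card_fin, sampleCount]
  push_cast
  field_simp
  norm_num

theorem exp_neg_natCast_le (j : ℕ) : Real.exp (-j) ≤ 1 / 2 ^ j := by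
  have htwo : (2 : ℝ) ≤ Real.exp 1 := by linarith [Real.add_one_le_exp (1 : ℝ)]
  rw [Real.exp_neg, ← one_div, ← mul_one (j : ℝ), Real.exp_nat_mul]
  gcongr

open Classical in
theorem expect_not_accurate_le (I : ECSInstance) (k : ℕ) :
    𝔼 y : Fin (sampleCount I.n k) → I.Voter × I.Voter → Fin (bitCount I.n) → Bool,
      (if Accurate y then (0 : ℝ) else 1) ≤ 1 / 2 ^ k := by
  let deviates (T : Finset I.Voter)
      (y : Fin (sampleCount I.n k) → I.Voter × I.Voter → Fin (bitCount I.n) → Bool) : Prop :=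
    sampleCount I.n k * (1 / (36 * (I.n : ℝ) ^ 2)) ≤
      |∑ i, (((I.covered (drawGraph (y i)) T).card : ℝ) -
        𝔼 ω : I.Voter × I.Voter → Fin (bitCount I.n) → Bool,
          ((I.covered (drawGraph ω) T).card : ℝ))|
  have hunion (y) : (if Accurate y then (0 : ℝ) else 1) ≤
      ∑ T, if deviates T y then (1 : ℝ) else 0 := by
    have hnonneg (T) : (0 : ℝ) ≤ if deviates T y then (1 : ℝ) else 0 := by split_ifs <;> norm_num
    split_ifs with hy
    · exact Finset.sum_nonneg fun T _ => hnonneg T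
    · obtain ⟨T, hT⟩ : ∃ T, deviates T y := by
        by_contra! hsmall
        exact hy (accurate_of_abs_sum_le fun T => (not_le.1 (hsmall T)).le)
      refine le_trans (by rw [if_pos hT]) (Finset.single_le_sum (fun T _ => hnonneg T)
        (Finset.mem_univ T))
  calc 𝔼 y : Fin (sampleCount I.n k) → I.Voter × I.Voter → Fin (bitCount I.n) → Bool,
        (if Accurate y then (0 : ℝ) else 1)
      ≤ 𝔼 y, ∑ T, (if deviates T y then (1 : ℝ) else 0) :=
        Finset.expect_le_expect fun y _ => hunion y
    _ = ∑ T, 𝔼 y, (if deviates T y then (1 : ℝ) else 0) := Finset.expect_sum_comm _ _ _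
    _ ≤ ∑ _T : Finset I.Voter, 2 * Real.exp (-(I.n + 1 + k : ℕ)) :=
        Finset.sum_le_sum fun T _ => expect_abs_sum_card_covered_ge_le k _ T
    _ ≤ 2 ^ I.n * (2 * (1 / 2 ^ (I.n + 1 + k))) := by
        rw [Finset.sum_const, Finset.card_univ, Fintype.card_finset, Fintype.card_fin,
          nsmul_eq_mul, Nat.cast_pow, Nat.cast_ofNat]
        gcongr
        exact exp_neg_natCast_le _
    _ = 1 / 2 ^ k := by
        rw [pow_add, pow_add]
        field_simp

end Accuracy

section Approximation

theorem opposed_nonempty (hδ : 0 < I.delta) : I.opposed.Nonempty := by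
  obtain ⟨x, -, hx⟩ := Finset.exists_mem_eq_sup' I.pairs_nonempty
    fun x : I.Voter × I.Candidate => (I.score x.1 x.2 : ℤ) - (I.score x.1 0 : ℤ)
  have hpos : 0 < (I.score x.1 x.2 : ℤ) - (I.score x.1 0 : ℤ) := hx ▸ hδ
  exact ⟨x.1, mem_opposed.2 ⟨x.2, by omega⟩⟩

theorem one_le_expCover_singleton {v : I.Voter} (hv : v ∈ I.opposed) : 1 ≤ I.expCover {v} := by
  have hself (H : Finset (I.Voter × I.Voter)) : v ∈ I.covered H {v} :=
    mem_covered.2 ⟨hv, v, Finset.mem_singleton_self v, 0, Finset.mem_singleton_self v⟩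
  calc (1 : ℝ) = I.expect fun _ => 1 := (subsetExpect_const _ _ _).symm
    _ ≤ I.expCover {v} := expect_mono fun H => Nat.one_le_cast.2 (Finset.card_pos.2 ⟨v, hself H⟩)

variable {N m : ℕ} {y : Fin N → I.Voter × I.Voter → Fin m → Bool}

theorem Accurate.mul_expCover_sub_le (hy : Accurate y) (hN : 0 < N) {c : ℝ}
    (hc : c ∈ Set.Icc (0 : ℝ) 1) {S T : Finset I.Voter}
    (h : c * sampleCover y T ≤ sampleCover y S) :
    c * I.expCover T - 1 / (9 * (I.n : ℝ) ^ 2) ≤ I.expCover S := by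
  set η : ℝ := 1 / (18 * (I.n : ℝ) ^ 2)
  have hη : 1 / (9 * (I.n : ℝ) ^ 2) = 2 * η := by simp only [η]; ring
  have hN' : (0 : ℝ) < N := Nat.cast_pos.2 hN
  refine le_of_mul_le_mul_left ?_ hN'
  calc N * (c * I.expCover T - 1 / (9 * (I.n : ℝ) ^ 2))
      = c * (N * I.expCover T - N * η) + c * (N * η) - 2 * (N * η) := by rw [hη]; ring
    _ ≤ c * sampleCover y T + 1 * (N * η) - 2 * (N * η) := by
        have hT := (abs_le.1 (hy T)).1
        gcongr
        · exact hc.1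
        · linarith
        · exact hc.2
    _ ≤ sampleCover y S - N * η := by linarith
    _ ≤ N * I.expCover S := by linarith [(abs_le.1 (hy S)).2]

theorem Accurate.two_mul_ratio_mul_expCover_le (hδ : 0 < I.delta) (hB : I.delta ≤ I.B)
    (hy : Accurate y) (hN : 0 < N) {K : ℕ} {S T : Finset I.Voter} (hK : I.seedCount ≤ K)
    (hS : GreedyReachable (fun T => (sampleCover y T : ℝ)) K S) (hT : T.card ≤ I.maxSeeds)
    (hone : 1 ≤ I.expCover T) : 2 * I.ratio * I.expCover T ≤ I.expCover S := by
  set c : ℝ := 1 - (1 - 1 / (I.maxSeeds : ℝ)) ^ K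
  set η : ℝ := 1 / (9 * (I.n : ℝ) ^ 2)
  have hD := maxSeeds_pos hδ hB
  have hbase : (0 : ℝ) ≤ 1 - 1 / I.maxSeeds :=
    sub_nonneg.2 (div_le_one_of_le₀ (Nat.one_le_cast.2 hD) (by positivity))
  have hratio : 2 * I.ratio + η ≤ c := two_mul_ratio_add_le hδ hB hK
  have hη : 0 ≤ η := by positivity
  have hc : c ∈ Set.Icc (0 : ℝ) 1 :=
    ⟨by linarith [ratio_nonneg hδ hB], sub_le_self _ (pow_nonneg hbase K)⟩
  have hgreedy : c * sampleCover y T ≤ sampleCover y S :=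
    (isMonotoneSubmodular_sampleCover y).le_of_greedyReachable hS hD hT
  calc 2 * I.ratio * I.expCover T
      ≤ (c - η) * I.expCover T := by gcongr; linarith
    _ = c * I.expCover T - η * I.expCover T := sub_mul _ _ _
    _ ≤ c * I.expCover T - η := sub_le_sub_left (le_mul_of_one_le_right hη hone) _
    _ ≤ I.expCover S := hy.mul_expCover_sub_le hN hc hgreedy

-- The additive error of the samples is absorbed only where the expected coverage is at least `1`;
-- any other set is compared with a single opposed voter, whose expected coverage is at least `1`.
theorem Accurate.isApprox (hδ : 0 < I.delta) (hB : I.delta ≤ I.B) (hy : Accurate y) (hN : 0 < N)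
    {K : ℕ} {S : List I.Voter} (hnodup : S.Nodup) (hlen : S.length ≤ I.seedCount)
    (hK : I.seedCount ≤ K)
    (hS : GreedyReachable (fun T => (sampleCover y T : ℝ)) K S.toFinset) :
    I.IsApprox I.ratio (I.deltaPlan S) := by
  refine isApprox_deltaPlan hδ hB hnodup hlen fun T hT => ?_
  rcases le_or_gt 1 (I.expCover T) with hone | hsmall
  · exact hy.two_mul_ratio_mul_expCover_le hδ hB hN hK hS hT hone
  · obtain ⟨v, hv⟩ := opposed_nonempty hδ
    have hone := one_le_expCover_singleton hv
    have hratio := ratio_nonneg hδ hB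
    calc 2 * I.ratio * I.expCover T ≤ 2 * I.ratio * I.expCover {v} := by gcongr; linarith
      _ ≤ I.expCover S.toFinset := hy.two_mul_ratio_mul_expCover_le hδ hB hN hK hS
          ((Finset.card_singleton v).trans_le (maxSeeds_pos hδ hB)) hone

end Approximation

section Output

theorem cast_num_toNat_eq {q : I.Voter × I.Voter → ℚ} (hq : ∀ e, I.p e = (q e : ℝ))
    (e : I.Voter × I.Voter) : ((q e).num.toNat : ℝ) = I.p e * (q e).den := by
  have hnonneg : 0 ≤ q e := by exact_mod_cast hq e ▸ I.p_nonneg e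
  have hnum : ((q e).num.toNat : ℚ) = q e * (q e).den := by
    rw [Rat.mul_den_eq_num, ← Int.cast_natCast, Int.toNat_of_nonneg (Rat.num_nonneg.2 hnonneg)]
  rw [hq]
  exact_mod_cast hnum

variable {q : I.Voter × I.Voter → ℚ} (hq : ∀ e, I.p e = (q e : ℝ)) {k C : ℕ}
  (h : sampleCount I.n k * I.n * I.n * bitCount I.n ≤ C) (r : Fin C → Bool)

include hq

theorem isLive_rawEdge (i : Fin (sampleCount I.n k)) (e : I.Voter × I.Voter) :
    isLive ((List.ofFn r).map Bool.toNat) (bitCount I.n) I.n i (rawEdge q e) ↔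
      (ofBits (bitCount I.n) (coinTable h r i e) : ℝ) < I.p e * 2 ^ bitCount I.n := by
  have hden : (0 : ℝ) < (q e).den := Nat.cast_pos.2 (q e).den_pos
  have hindex (b : Fin (bitCount I.n)) : ((i * I.n + e.1) * I.n + e.2) * bitCount I.n + b < C :=
    val_coinIndex h i e.1 e.2 b ▸ (coinIndex h (i, e, b)).2
  have hdraw : draw ((List.ofFn r).map Bool.toNat) (bitCount I.n) ((i * I.n + e.1) * I.n + e.2) =
      ofBits (bitCount I.n) (coinTable h r i e) := by
    rw [draw_eq_ofBits r hindex]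
    congr 2 with b
    exact congrArg r (Fin.ext (val_coinIndex h i e.1 e.2 b).symm)
  simp only [isLive, rawEdge, hdraw, decide_eq_true_eq]
  rw [← Nat.cast_lt (α := ℝ)]
  push_cast
  rw [cast_num_toNat_eq hq, mul_right_comm, mul_lt_mul_iff_left₀ hden]

theorem sampleValue_rawInput (S : List I.Voter) :
    sampleValue (I.rawInput q k, (List.ofFn r).map Bool.toNat) (S.map Fin.val) =
      sampleCover (coinTable h r) S.toFinset := by
  classical
  let liveEdges (i : Fin (sampleCount I.n k)) : List (I.Voter × I.Voter) :=
    I.edgeList.filter fun e =>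
      isLive ((List.ofFn r).map Bool.toNat) (bitCount I.n) I.n i (rawEdge q e)
  have hgraphs : sampleGraphs ((List.ofFn r).map Bool.toNat) (bitCount I.n) I.n
      (sampleCount I.n k) (I.edgeList.map (rawEdge q)) =
      ((List.finRange (sampleCount I.n k)).map liveEdges).map fun H => H.map (rawEdge q) := by
    rw [sampleGraphs, ← List.map_coe_finRange_eq_range, List.map_map, List.map_map]
    refine List.map_congr_left fun i _ => ?_
    rw [Function.comp_apply, Function.comp_apply, List.filter_map]
    rfl
  have hset (i) : (liveEdges i).toFinset = drawGraph (coinTable h r i) := by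
    ext e
    have hmem : e ∈ (List.finRange I.n).product (List.finRange I.n) :=
      List.mem_product.2 ⟨List.mem_finRange e.1, List.mem_finRange e.2⟩
    simp only [liveEdges, edgeList, drawGraph, List.mem_toFinset, List.mem_filter, hmem,
      Finset.mem_filter, decide_eq_true_eq, true_and, isLive_rawEdge hq h r i e]
  simp only [sampleValue, rawInput, length_scoreRows, List.length_replicate]
  rw [hgraphs, value_eq, List.map_map, sampleCover, ← List.sum_ofFn, List.ofFn_eq_map]
  simp only [Function.comp_def, hset]

omit hq

theorem toVal_message (hδ : 0 < I.delta) :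
    toVal (message I.delta.toNat (I.ℓ + 1)) =
      Val.ofList ((List.finRange (I.ℓ + 1)).map fun c =>
        Val.pair (Val.num ((Pi.single 0 I.delta : I.Message) c).toNat)
          (Val.num (-(Pi.single 0 I.delta : I.Message) c).toNat)) := by
  rw [message, ← List.map_coe_finRange_eq_range, List.map_map]
  simp only [toVal, List.map_map]
  congr 1
  refine List.map_congr_left fun c _ => ?_
  rcases eq_or_ne c 0 with rfl | hc
  · simp
    omega
  · simp [hc, Fin.val_ne_zero_iff.2 hc]

theorem toVal_algorithm (hδ : 0 < I.delta) {x : RawInput × List ℕ} (hx : x.1.1.1 = I.scoreRows)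
    {S : List I.Voter} (hS : selectedSeeds x = S.map Fin.val) :
    toVal (algorithm x) = encodePlan (I.deltaPlan S) := by
  have hlen : (I.scoreRows.getD 0 []).length = I.ℓ + 1 := by
    simpa using congrArg List.length (getD_scoreRows (I := I) ⟨0, I.n_pos⟩)
  rw [algorithm, hS, hx, maxExcess_scoreRows, hlen, encodePlan, deltaPlan, List.map_map,
    List.map_map]
  change Val.ofList (List.map toVal _) = _
  rw [List.map_map]
  congr 1
  refine List.map_congr_left fun s _ => ?_
  exact congrArg (Val.pair (Val.num s)) (toVal_message hδ)

theorem sampleCount_pos (I : ECSInstance) (k : ℕ) : 0 < sampleCount I.n k := by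
  have := I.n_pos
  unfold sampleCount
  positivity

theorem exists_toVal_algorithm_eq (hδ : 0 < I.delta) (hB : I.delta ≤ I.B)
    (hq : ∀ e, I.p e = (q e : ℝ)) :
    ∃ L : I.Plan,
      toVal (algorithm (I.rawInput q k, (List.ofFn r).map Bool.toNat)) = encodePlan L ∧
      I.Feasible L ∧ I.GreedyBuilt L ∧ (Accurate (coinTable h r) → I.IsApprox I.ratio L) := by
  obtain ⟨S, K, heq, hchain, hlen, hK, hS⟩ := exists_greedySeeds_eq I.n_pos
    (sampleValue_rawInput hq h r) (Int.pos_iff_toNat_pos.1 hδ) I.B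
  have hsel : selectedSeeds (I.rawInput q k, (List.ofFn r).map Bool.toNat) = S.map Fin.val := by
    rw [← heq, selectedSeeds]
    simp only [rawInput, length_scoreRows, maxExcess_scoreRows]
  exact ⟨I.deltaPlan S, toVal_algorithm hδ rfl hsel, feasible_deltaPlan hδ hchain.nodup hlen,
    greedyBuilt_deltaPlan hδ hchain,
    fun hy => hy.isApprox hδ hB (sampleCount_pos I k) hchain.nodup hlen hK hS⟩

theorem one_sub_le_coinProb {A : Set (Fin C → Bool)}
    (hA : ∀ r, Accurate (coinTable h r) → r ∈ A) : 1 - 1 / 2 ^ k ≤ coinProb A := by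
  classical
  calc 1 - 1 / 2 ^ k
      ≤ 1 - 𝔼 r : Fin C → Bool, (if Accurate (coinTable h r) then (0 : ℝ) else 1) := by
        rw [expect_coinTable h fun y => if Accurate y then (0 : ℝ) else 1]
        exact sub_le_sub_left (expect_not_accurate_le I k) 1
    _ = 𝔼 r : Fin C → Bool, (1 - if Accurate (coinTable h r) then (0 : ℝ) else 1) := by
        rw [Finset.expect_sub_distrib, Fintype.expect_const]
    _ ≤ 𝔼 r, (if r ∈ A then (1 : ℝ) else 0) := by
        refine Finset.expect_le_expect fun r _ => ?_
        split_ifs with hr hmem hmem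
        · rw [sub_zero]
        · exact absurd (hA r hr) hmem
        · norm_num
        · rw [sub_self]
    _ = coinProb A := (coinProb_eq_expect A).symm

end Output

/-- A polynomial in the input length that bounds the number of random bits that are used. -/
noncomputable def coinPoly : Polynomial ℕ :=
  648 * Polynomial.X ^ 6 * (Polynomial.X + 1 + Polynomial.X) * Polynomial.X * Polynomial.X *
    (11 * Polynomial.X)

theorem le_eval_coinPoly (q : I.Voter × I.Voter → ℚ) (k : ℕ) :
    sampleCount I.n k * I.n * I.n * bitCount I.n ≤
      coinPoly.eval (valSize (I.rawInput q k)) := by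
  have hsize : valSize (I.rawInput q k) = 1 + (1 + valSize I.scoreRows +
      valSize (I.edgeList.map (rawEdge q), I.B, 0)) + valSize (List.replicate k 0) := rfl
  have hrows := length_lt_valSize I.scoreRows
  have hunary := length_lt_valSize (List.replicate k 0)
  rw [length_scoreRows] at hrows
  rw [List.length_replicate] at hunary
  have hn : I.n ≤ valSize (I.rawInput q k) := by omega
  have hk : k ≤ valSize (I.rawInput q k) := by omega
  simp only [coinPoly, sampleCount, bitCount, Polynomial.eval_mul, Polynomial.eval_pow,
    Polynomial.eval_add, Polynomial.eval_X, Polynomial.eval_ofNat, Polynomial.eval_one]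
  gcongr

end ECSInstance

theorem theorem2 :
    -- the greedy algorithm with exact expectations
    (∀ I : ECSInstance, 0 < I.delta → I.delta ≤ I.B →
      ∀ S : List I.Voter, I.GreedySeeds S → S.length = min (I.B / I.delta.toNat) I.n →
        I.IsApprox I.ratio (I.deltaPlan S)) ∧
    -- a randomized polynomial-time greedy algorithm
    (∃ (P : Prog) (coins steps : Polynomial ℕ),
      ∀ (I : ECSInstance) (q : I.Voter × I.Voter → ℚ), (∀ e, I.p e = (q e : ℝ)) →
        0 < I.delta → I.delta ≤ I.B →
        ∀ k : ℕ, ∃ sol : (Fin (coins.eval (I.encodeInput q k).size) → Bool) → I.Plan,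
          (∀ r, P.time (I.encodeInput q k) r ≤ steps.eval (I.encodeInput q k).size ∧
            P.output (I.encodeInput q k) r = ECSInstance.encodePlan (sol r) ∧
            I.Feasible (sol r) ∧ I.GreedyBuilt (sol r)) ∧
          1 - 1 / 2 ^ k ≤ coinProb {r | I.IsApprox I.ratio (sol r)}) := by
  refine ⟨fun I hδ hB S hS hlen => hS.isApprox hδ hB hlen, ?_⟩
  obtain ⟨P, steps, hP⟩ := GreedySampling.polyTime_algorithm.exists_prog ECSInstance.coinPoly
  refine ⟨P, ECSInstance.coinPoly, steps, fun I q hq hδ hB k => ?_⟩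
  rw [← ECSInstance.toVal_rawInput q k]
  have hbits := ECSInstance.le_eval_coinPoly (I := I) q k
  choose sol houtput hfeasible hbuilt happrox using fun r =>
    ECSInstance.exists_toVal_algorithm_eq hbits r hδ hB hq
  exact ⟨sol, fun r => ⟨(hP _ r).1, (hP _ r).2.trans (houtput r), hfeasible r, hbuilt r⟩,
    ECSInstance.one_sub_le_coinProb hbits happrox⟩
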